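/- Let $a,m,r$ be integers with $a,m\ge 1$ and $0\le r<a$. A polynomial $F\in\mathbb{C}[x,y]$ is said to be of bidegree $(a,b)$ if its Newton polygon (the convex hull of the exponents $(i,j)$ of the monomials $x^iy^j$ occurring in $F$) lies in the triangle spanned by $(a,0)$, $(0,0)$ and $(0,b)$. It has a singularity of type $A_k$ at a point $p\in\mathbb{C}^2$ if there are local analytic coordinates $(u,v)$ centred at $p$ in which the curve $F=0$ is given by $v^2-u^{k+1}=0$, that is, $F$ equals $v^2-u^{k+1}$ times a nonvanishing analytic function near $p$ (for $k=0$ this means that $p$ is a smooth point of the curve). Let $\mathbb{F}_m$ be the $m$-th Hirzebruch surface, the quotient of $(\mathbb{C}^2\setminus\{0\})^2$ by the relation $((x_0,x_1),(y_0,y_1))\sim((\mu x_0,\lambda^{-m}\mu x_1),(\lambda y_0,\lambda y_1))$ for $\lambda,\mu\in\mathbb{C}^*$. Let $S_+\subset\mathbb{F}_m$ be the section $x_0=0$, and embed $\mathbb{A}^2$ into $\mathbb{F}_m$ by $\iota_m\colon(x,y)\mapsto[x:1;y:1]$. An $(a,am)$-divisor of a polynomial $F$ of bidegree $(a,am)$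 is an effective divisor $C$ on $\mathbb{F}_m$ that is linearly equivalent to $aS_+$ and whose restriction to $\iota_m(\mathbb{A}^2)$ is the divisor of $F$. Let $F\in\mathbb{C}[x,y]$ be a polynomial of bidegree $(a,am-r)$ with a singularity of type $A_k$ at some point of $\mathbb{C}^2$, where $k\ge 0$, and suppose that its $(a,am)$-divisor is irreducible. Then $$k\le (a-1)(am-2).$$ If moreover $a\ge 3$ and $r=2$, then $$k\le (a-1)(am-2)-2.$$ -/

import Mathlib

open scoped Topology

namespace HirzebruchCurve

noncomputable section

/-! ### Plane polynomials: bidegree and singularities of type `A_k`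

The coordinates of the affine plane are `x = X 0` and `y = X 1`. -/

/-- The Newton polygon of `F`: the convex hull of the exponents `(i, j)` of the monomials
`x ^ i * y ^ j` occurring in `F`. -/
def newtonPolygon (F : MvPolynomial (Fin 2) ℂ) : Set (Fin 2 → ℝ) :=
  convexHull ℝ ((fun (e : Fin 2 →₀ ℕ) (i : Fin 2) => (e i : ℝ)) '' (F.support : Set (Fin 2 →₀ ℕ)))

/-- `F` is of bidegree `(a, b)`: its Newton polygon lies in the triangle spanned by `(a, 0)`,
`(0, 0)` and `(0, b)`. -/
def HasBidegree (F : MvPolynomial (Fin 2) ℂ) (a b : ℕ) : Prop :=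
  newtonPolygon F ⊆ convexHull ℝ {![(a : ℝ), 0], ![0, 0], ![0, (b : ℝ)]}

/-- The curve `F = 0` in the affine plane has a singularity of type `A_k` at the point `p`: in
suitable local analytic coordinates `χ` centred at `p` the curve is given by `y ^ 2 - x ^ (k + 1)`,
that is, `F` equals this function times a nonvanishing analytic function near `p`.
(For `k = 0` this says that `p` is a smooth point of the curve.) -/
def HasSingularityA (F : MvPolynomial (Fin 2) ℂ) (k : ℕ) (p : Fin 2 → ℂ) : Prop :=
  ∃ (χ : OpenPartialHomeomorph (Fin 2 → ℂ) (Fin 2 → ℂ)) (w : (Fin 2 → ℂ) → ℂ),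
    p ∈ χ.source ∧ χ p = 0 ∧
    AnalyticOnNhd ℂ χ χ.source ∧ AnalyticOnNhd ℂ χ.symm χ.target ∧
    AnalyticAt ℂ w p ∧ w p ≠ 0 ∧
    ∀ᶠ z in 𝓝 p, MvPolynomial.eval z F = w z * ((χ z 1) ^ 2 - (χ z 0) ^ (k + 1))

/-! ### The Hirzebruch surface `𝔽_m`

`𝔽_m` is the quotient of `(𝔸² ∖ 0)²` by
`((x₀, x₁), (y₀, y₁)) ∼ ((μ x₀, λ⁻ᵐ μ x₁), (λ y₀, λ y₁))`. It is covered by the four open sets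
`U (i, j) = {x_i ≠ 0, y_j ≠ 0}`, each of them an affine plane. Its function field is `ℂ(x, y)`
with `x = x₀ / (x₁ y₁ᵐ)` and `y = y₀ / y₁`; these are the coordinates of the affine plane
embedded by `(x, y) ↦ [x : 1 ; y : 1]`, whose image is `U (1, 1)`. We describe `𝔽_m` by its
function field and by the coordinate rings of the four charts, as subrings of that field. The
surface is separated, so the coordinate ring of `U c ∩ U d` is the subring generated by the
coordinate rings of `U c` and of `U d`. -/

/-- The function field `ℂ(x, y)` of the Hirzebruch surfaces. -/
abbrev FunField : Type := FractionRing (MvPolynomial (Fin 2) ℂ)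

/-- The class in the function field of a polynomial in `x` and `y`. -/
def ofPoly (F : MvPolynomial (Fin 2) ℂ) : FunField := algebraMap _ FunField F

lemma ofPoly_X_ne_zero (i : Fin 2) : ofPoly (MvPolynomial.X i) ≠ 0 := by
  unfold ofPoly
  intro h
  exact MvPolynomial.X_ne_zero (R := ℂ) i
    ((IsFractionRing.injective (MvPolynomial (Fin 2) ℂ) FunField) (by rw [h, map_zero]))

/-- The rational function `x = x₀ / (x₁ y₁ᵐ)`. -/
def xx : FunFieldˣ := Units.mk0 (ofPoly (MvPolynomial.X 0)) (ofPoly_X_ne_zero 0)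

/-- The rational function `y = y₀ / y₁`. -/
def yy : FunFieldˣ := Units.mk0 (ofPoly (MvPolynomial.X 1)) (ofPoly_X_ne_zero 1)

/-- The index `(i, j)` stands for the chart `U (i, j) = {x_i ≠ 0, y_j ≠ 0}`. -/
abbrev Chart : Type := Fin 2 × Fin 2

/-- The rational function `x₀ / (x₁ y_jᵐ)`. -/
def ratioX (m : ℕ) (j : Fin 2) : FunFieldˣ := if j = 0 then xx * (yy ^ m)⁻¹ else xx

/-- The coordinate of `U (i, j)` along the fibers: `x₁ y_jᵐ / x₀` if `i = 0` and
`x₀ / (x₁ y_jᵐ)` if `i = 1`. -/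
def coordX (m : ℕ) (c : Chart) : FunFieldˣ :=
  if c.1 = 0 then (ratioX m c.2)⁻¹ else ratioX m c.2

/-- The coordinate of `U (i, j)` pulled back from the base: `y₁ / y₀` if `j = 0` and `y₀ / y₁` if
`j = 1`. -/
def coordY (c : Chart) : FunFieldˣ := if c.2 = 0 then yy⁻¹ else yy

/-- The coordinate ring of the affine plane `U c`. -/
def chartRing (m : ℕ) (c : Chart) : Subalgebra ℂ FunField :=
  Algebra.adjoin ℂ {(coordX m c : FunField), (coordY c : FunField)}

/-- The group of units of a subring `R` of the function field. -/
def unitGroup (R : Subalgebra ℂ FunField) : Subgroup FunFieldˣ where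
  carrier := {u | (u : FunField) ∈ R ∧ ((u⁻¹ : FunFieldˣ) : FunField) ∈ R}
  one_mem' := by simp [one_mem]
  mul_mem' := fun {u v} hu hv => by
    refine ⟨?_, ?_⟩
    · rw [Units.val_mul]
      exact mul_mem hu.1 hv.1
    · rw [mul_inv, Units.val_mul]
      exact mul_mem hu.2 hv.2
  inv_mem' := fun {u} hu => ⟨hu.2, by rw [inv_inv]; exact hu.1⟩

/-- The units of `R`, written additively. -/
def unitsOf (R : Subalgebra ℂ FunField) : AddSubgroup (Additive FunFieldˣ) :=
  Subgroup.toAddSubgroup (unitGroup R)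

lemma unitsOf_mono {R S : Subalgebra ℂ FunField} (h : R ≤ S) : unitsOf R ≤ unitsOf S := by
  intro u hu
  exact ⟨h hu.1, h hu.2⟩

/-! ### Divisors on `𝔽_m`

On the smooth surface `𝔽_m` divisors are the same as Cartier divisors. Every divisor on an affine
plane is principal, so a divisor on `𝔽_m` is given by one rational function on each of the four
charts, up to units of the coordinate ring of the chart, such that these local equations differ by
units on the overlaps of the charts. -/

/-- Local equations on the open set with coordinate ring `R`: nonzero rational functions up to units
of `R`. The group law is the multiplication of functions, written additively. -/
abbrev LocalDiv (R : Subalgebra ℂ FunField) : Type := Additive FunFieldˣ ⧸ unitsOf R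

/-- The divisor on the open set with coordinate ring `R` of a nonzero rational function. -/
def localDiv (R : Subalgebra ℂ FunField) (g : FunFieldˣ) : LocalDiv R :=
  QuotientAddGroup.mk (Additive.ofMul g)

/-- Restriction of divisors to a smaller open set. -/
def restrict {R S : Subalgebra ℂ FunField} (h : R ≤ S) : LocalDiv R →+ LocalDiv S :=
  QuotientAddGroup.map (unitsOf R) (unitsOf S) (AddMonoidHom.id _) (unitsOf_mono h)

/-- The group of divisors on `𝔽_m`. -/
def divisorGroup (m : ℕ) : AddSubgroup (∀ c : Chart, LocalDiv (chartRing m c)) where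
  carrier := {D | ∀ c d : Chart,
    restrict (le_sup_left : chartRing m c ≤ chartRing m c ⊔ chartRing m d) (D c) =
    restrict (le_sup_right : chartRing m d ≤ chartRing m c ⊔ chartRing m d) (D d)}
  zero_mem' := fun c d => by simp
  add_mem' := fun {D E} hD hE c d => by simp [hD c d, hE c d]
  neg_mem' := fun {D} hD c d => by simp [hD c d]

/-- A divisor on `𝔽_m`. -/
abbrev Divisor (m : ℕ) : Type := divisorGroup m

/-- The divisor with given local equations, provided that they differ by units on overlaps. -/
def Divisor.ofEquations (m : ℕ) (f : Chart → FunFieldˣ)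
    (h : ∀ c d : Chart, ((f c)⁻¹ * f d) ∈ unitGroup (chartRing m c ⊔ chartRing m d)) :
    Divisor m :=
  ⟨fun c => localDiv _ (f c), fun c d => QuotientAddGroup.eq.mpr (h c d)⟩

/-- The principal divisor of a nonzero rational function. -/
def Divisor.principal (m : ℕ) (g : FunFieldˣ) : Divisor m :=
  Divisor.ofEquations m (fun _ => g) fun c d => by
    rw [inv_mul_cancel]
    exact one_mem _

/-- Linear equivalence of divisors. -/
def LinEquiv {m : ℕ} (D E : Divisor m) : Prop := ∃ g : FunFieldˣ, D - E = Divisor.principal m g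

/-- A divisor is effective if all its local equations are regular functions. -/
def IsEffective {m : ℕ} (D : Divisor m) : Prop :=
  ∀ c : Chart, ∃ g : FunFieldˣ, (g : FunField) ∈ chartRing m c ∧ D.1 c = localDiv _ g

/-- A divisor is irreducible (a prime divisor) if it is effective, nonzero, and not the sum of two
nonzero effective divisors. -/
def IsIrreducible {m : ℕ} (D : Divisor m) : Prop :=
  IsEffective D ∧ D ≠ 0 ∧
    ∀ D₁ D₂ : Divisor m, IsEffective D₁ → IsEffective D₂ → D = D₁ + D₂ → D₁ = 0 ∨ D₂ = 0

/-- The local equations of the section `x₀ = 0`. -/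
def sectionPlusEqn (m : ℕ) (c : Chart) : FunFieldˣ := if c.1 = 0 then 1 else coordX m c

lemma coordX_mem (m : ℕ) (c : Chart) : (coordX m c : FunField) ∈ chartRing m c :=
  Algebra.subset_adjoin (by simp)

lemma coordY_mem (m : ℕ) (c : Chart) : (coordY c : FunField) ∈ chartRing m c :=
  Algebra.subset_adjoin (by simp)

lemma ratioX_compat (m : ℕ) (c d : Chart) :
    (ratioX m c.2)⁻¹ * ratioX m d.2 ∈ unitGroup (chartRing m c ⊔ chartRing m d) := by
  have hc : (coordY c : FunField) ∈ chartRing m c ⊔ chartRing m d :=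
    (le_sup_left : chartRing m c ≤ _) (coordY_mem m c)
  have hd : (coordY d : FunField) ∈ chartRing m c ⊔ chartRing m d :=
    (le_sup_right : chartRing m d ≤ _) (coordY_mem m d)
  obtain ⟨i, j⟩ := c
  obtain ⟨k, l⟩ := d
  have h01 : ∀ t : Fin 2, t = 0 ∨ t = 1 := by decide
  rcases h01 j with rfl | rfl <;> rcases h01 l with rfl | rfl
  · rw [inv_mul_cancel]
    exact one_mem _
  · have e : (ratioX m 0)⁻¹ * ratioX m 1 = yy ^ m := by simp [ratioX, mul_comm]
    simp only [e]
    refine pow_mem (show yy ∈ unitGroup _ from ⟨?_, ?_⟩) m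
    · simpa [coordY] using hd
    · simpa [coordY] using hc
  · have e : (ratioX m 1)⁻¹ * ratioX m 0 = yy⁻¹ ^ m := by simp [ratioX]
    simp only [e]
    refine pow_mem (show yy⁻¹ ∈ unitGroup _ from ⟨?_, ?_⟩) m
    · simpa [coordY] using hd
    · simpa [coordY] using hc
  · rw [inv_mul_cancel]
    exact one_mem _

lemma sectionPlus_compat (m : ℕ) (c d : Chart) :
    (sectionPlusEqn m c)⁻¹ * sectionPlusEqn m d ∈
      unitGroup (chartRing m c ⊔ chartRing m d) := by
  have hr := ratioX_compat m c d
  have hc : (coordX m c : FunField) ∈ chartRing m c ⊔ chartRing m d :=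
    (le_sup_left : chartRing m c ≤ _) (coordX_mem m c)
  have hd : (coordX m d : FunField) ∈ chartRing m c ⊔ chartRing m d :=
    (le_sup_right : chartRing m d ≤ _) (coordX_mem m d)
  obtain ⟨hr₁, hr₂⟩ := id hr
  obtain ⟨i, j⟩ := c
  obtain ⟨k, l⟩ := d
  have h01 : ∀ t : Fin 2, t = 0 ∨ t = 1 := by decide
  rcases h01 i with rfl | rfl <;> rcases h01 k with rfl | rfl
  · simp [sectionPlusEqn, one_mem]
  · refine ⟨?_, ?_⟩
    · simpa [sectionPlusEqn] using hd
    · have e : ((1 : FunFieldˣ)⁻¹ * ratioX m l)⁻¹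
          = (ratioX m j)⁻¹ * ((ratioX m j)⁻¹ * ratioX m l)⁻¹ := by
        rw [mul_inv_rev, mul_inv_rev, inv_inv, mul_one, mul_comm (ratioX m l)⁻¹,
          mul_inv_cancel_left]
      have := mul_mem (show (((ratioX m j)⁻¹ : FunFieldˣ) : FunField) ∈ _ by
        simpa only [coordX, if_true] using hc) hr₂
      simpa only [sectionPlusEqn, coordX, if_true, one_ne_zero, if_false, e, Units.val_mul]
        using this
  · refine ⟨?_, ?_⟩
    · have e : (ratioX m j)⁻¹ * (1 : FunFieldˣ)
          = ((ratioX m j)⁻¹ * ratioX m l) * (ratioX m l)⁻¹ := by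
        rw [mul_one, mul_inv_cancel_right]
      have := mul_mem hr₁ (show (((ratioX m l)⁻¹ : FunFieldˣ) : FunField) ∈ _ by
        simpa only [coordX, if_true] using hd)
      simpa only [sectionPlusEqn, coordX, if_true, one_ne_zero, if_false, e, Units.val_mul]
        using this
    · simpa [sectionPlusEqn] using hc
  · simpa only [sectionPlusEqn, coordX, one_ne_zero, if_false] using hr

/-- The section `S₊` given by `x₀ = 0`. -/
def sectionPlus (m : ℕ) : Divisor m :=
  Divisor.ofEquations m (sectionPlusEqn m) (sectionPlus_compat m)

/-- `C` is an `(a, am)`-divisor of `F`: an effective divisor on `𝔽_m`, linearly equivalent to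
`a S₊`, whose restriction to the affine plane `U (1, 1)` is the divisor of `F`. -/
def IsDivisorOf {m : ℕ} (a : ℕ) (F : MvPolynomial (Fin 2) ℂ) (C : Divisor m) : Prop :=
  IsEffective C ∧ LinEquiv C (a • sectionPlus m) ∧
    ∃ g : FunFieldˣ, (g : FunField) = ofPoly F ∧ C.1 (1, 1) = localDiv _ g

end

end HirzebruchCurve

/-! ### Local part: the contact filtration at a point of type `A_k`. -/

namespace HirzebruchCurve

open Filter Asymptotics MvPolynomial

/-! ### Taylor polynomials -/

/-! The bound is a genus estimate: an `A_k` point has delta invariant δ = ⌊(k+1)/2⌋, which cannot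
exceed the arithmetic genus (a-1)(am-2)/2 of the class aS₊. The proof compares dimensions instead of
normalising the curve.

Let J n be the ideal of polynomials vanishing to order 2n in t on both arcs (t², ±t^(k+1)) read in
the analytic coordinates. These ideals contain F, multiply well, and have codimension n + (n - δ),
with truncated subtraction (`exists_isBranchFiltration`). Irreducibility of the divisor makes F
irreducible with nonzero coefficient at x^a, so polynomials of x-degree below a are normal forms
modulo F. Counting them gives a weighted Bezout bound: an element of J M not divisible by F has
weight at least 2M (`two_mul_le_of_mem`).

Normal forms of weight at most 2M therefore meet J M in dimension at most one, just as a line bundle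
of degree 0 has at most one section. For if P₁, P₂ were independent there, the products P₁², P₁P₂,
P₂² would lie in J (2M), where J (2M+1) has codimension 2; some nonzero quadratic form in P₁, P₂
lies in J (2M+1), splits over ℂ into linear factors not divisible by F, and contradicts Bezout. This
is `card_add_le`; counting lattice points then bounds 2δ ≥ k. For r = 2 the smaller weight of x
admits one more exponent, lowering the bound by 2. -/

lemma exists_polynomial_of_multilinear {n : ℕ}
    (q : ContinuousMultilinearMap ℂ (fun _ : Fin n => Fin 2 → ℂ) ℂ) :
    ∃ Q : MvPolynomial (Fin 2) ℂ, ∀ h, eval h Q = q (fun _ => h) := by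
  refine ⟨∑ r : Fin n → Fin 2, C (q fun j => Pi.single (r j) 1) * ∏ j, X (r j), fun h => ?_⟩
  have hh : h = ∑ i, h i • (Pi.single i (1 : ℂ) : Fin 2 → ℂ) := by
    ext i
    fin_cases i <;> simp
  have key : q (fun _ => h) = q (fun _ => ∑ i, h i • (Pi.single i (1 : ℂ) : Fin 2 → ℂ)) := by
    rw [← hh]
  rw [key, ContinuousMultilinearMap.map_sum]
  simp only [map_sum, map_mul, eval_C, map_prod, eval_X]
  refine Finset.sum_congr rfl fun r _ => ?_
  rw [ContinuousMultilinearMap.map_smul_univ, smul_eq_mul, mul_comm]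

/-- Contact conditions of bounded order see only a finite jet, so analytic coordinate changes can be
truncated to polynomials. -/
lemma exists_taylor_polynomial {f : (Fin 2 → ℂ) → ℂ} {z₀ : Fin 2 → ℂ} (hf : AnalyticAt ℂ f z₀)
    (L : ℕ) :
    ∃ P : MvPolynomial (Fin 2) ℂ,
      (fun z => f z - eval z P) =O[𝓝 z₀] fun z => ‖z - z₀‖ ^ L := by
  obtain ⟨s, hs⟩ := hf
  choose Q hQ using fun n => exists_polynomial_of_multilinear (s n)
  have h := hs.isBigO_sub_partialSum_pow L
  refine ⟨aeval (fun i => X i - C (z₀ i)) (∑ n ∈ Finset.range L, Q n), ?_⟩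
  have ht : Tendsto (fun z => z - z₀) (𝓝 z₀) (𝓝 0) := by
    have : ContinuousAt (fun z => z - z₀) z₀ := by fun_prop
    simpa [ContinuousAt] using this
  refine (h.comp_tendsto ht).congr (fun z => ?_) fun z => rfl
  have he : eval z (aeval (fun i => X i - C (z₀ i)) (∑ n ∈ Finset.range L, Q n))
      = eval (z - z₀) (∑ n ∈ Finset.range L, Q n) := by
    rw [aeval_def, algebraMap_eq, eval_eval₂, eval]
    simp only [coe_eval₂Hom]
    congr 1
    · ext; simp
    · ext i; simp
  simp only [Function.comp_apply, add_sub_cancel]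
  rw [he, FormalMultilinearSeries.partialSum, map_sum]
  simp [hQ]

lemma X_pow_dvd_of_isBigO {N : ℕ} {p : Polynomial ℂ}
    (h : (fun t : ℂ => p.eval t) =O[𝓝 0] fun t => t ^ N) : Polynomial.X ^ N ∣ p := by
  induction N with
  | zero => simp
  | succ N ih =>
    have h' : (fun t : ℂ => p.eval t) =O[𝓝 0] fun t => t ^ N := by
      refine h.trans (IsBigO.of_bound 1 ?_)
      filter_upwards [Metric.closedBall_mem_nhds (0 : ℂ) one_pos] with t ht
      have ht' : ‖t‖ ≤ 1 := by simpa using ht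
      rw [one_mul, norm_pow, norm_pow]
      exact pow_le_pow_of_le_one (norm_nonneg _) ht' (Nat.le_succ N)
    obtain ⟨q, rfl⟩ := ih h'
    -- Away from 0 the factor t^N cancels; continuity then recovers the value of q at 0.
    have hq : (fun t : ℂ => q.eval t) =O[𝓝[≠] 0] fun t => t := by
      obtain ⟨c, hc⟩ := (h.mono (nhdsWithin_le_nhds (s := {0}ᶜ))).bound
      refine IsBigO.of_bound c ?_
      filter_upwards [hc, self_mem_nhdsWithin] with t ht h0
      have h0' : 0 < ‖t‖ ^ N := pow_pos (norm_pos_iff.mpr h0) N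
      simp only [Polynomial.eval_mul, Polynomial.eval_pow, Polynomial.eval_X, norm_mul, norm_pow,
        pow_succ] at ht
      refine le_of_mul_le_mul_left (ht.trans_eq ?_) h0'
      ring
    have hlim : Tendsto (fun t : ℂ => q.eval t) (𝓝[≠] 0) (𝓝 0) :=
      hq.trans_tendsto (tendsto_id.mono_left nhdsWithin_le_nhds)
    have hlim' : Tendsto (fun t : ℂ => q.eval t) (𝓝[≠] 0) (𝓝 (q.eval 0)) :=
      (q.continuous.tendsto 0).mono_left nhdsWithin_le_nhds
    have h0 : q.eval 0 = 0 := tendsto_nhds_unique hlim' hlim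
    rw [pow_succ]
    refine mul_dvd_mul_left _ ?_
    rw [Polynomial.X_dvd_iff, Polynomial.coeff_zero_eq_eval_zero, h0]

lemma eq_zero_of_sum_isBigO {ι : Type*} [Fintype ι] {N : ℕ} {e : ι → ℕ}
    (he : Function.Injective e) (hN : ∀ i, e i < N) {c : ι → ℂ}
    (h : (fun t : ℂ => ∑ i, c i * t ^ e i) =O[𝓝 0] fun t => t ^ N) (i : ι) : c i = 0 := by
  classical
  have h' : (fun t : ℂ => (∑ i, Polynomial.C (c i) * Polynomial.X ^ e i).eval t)
      =O[𝓝 0] fun t => t ^ N := by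
    simpa [Polynomial.eval_finsetSum] using h
  have hc := (Polynomial.X_pow_dvd_iff.mp (X_pow_dvd_of_isBigO h')) (e i) (hN i)
  simpa [Polynomial.finsetSum_coeff, Polynomial.coeff_C_mul, Polynomial.coeff_X_pow,
    he.eq_iff] using hc

/-! ### Order of contact with an arc -/

/-- The polynomials vanishing to order at least `n` along the arc `s`. -/
noncomputable def contactIdeal (s : ℂ → Fin 2 → ℂ) (hs : ContinuousAt s 0) (n : ℕ) :
    Ideal (MvPolynomial (Fin 2) ℂ) where
  carrier := {P | (fun t => eval (s t) P) =O[𝓝 0] fun t : ℂ => t ^ n}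
  zero_mem' := by
    simp only [Set.mem_ofPred_eq, map_zero]
    exact isBigO_zero _ _
  add_mem' := fun {P Q} hP hQ => by
    simp only [Set.mem_ofPred_eq, map_add]
    exact IsBigO.add hP hQ
  smul_mem' := fun c P hP => by
    have hc : (fun t => eval (s t) c) =O[𝓝 0] fun _ : ℂ => (1 : ℂ) := by
      have : ContinuousAt (fun t => eval (s t) c) 0 :=
        ((continuous_eval c).continuousAt).comp hs
      exact this.tendsto.isBigO_one ℂ
    simp only [Set.mem_ofPred_eq, smul_eq_mul, map_mul]
    simpa using hc.mul hP

lemma mem_contactIdeal {s : ℂ → Fin 2 → ℂ} {hs : ContinuousAt s 0} {n : ℕ}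
    {P : MvPolynomial (Fin 2) ℂ} :
    P ∈ contactIdeal s hs n ↔ (fun t => eval (s t) P) =O[𝓝 0] fun t : ℂ => t ^ n := Iff.rfl

/-- The arcs `(t ^ 2, ± t ^ (k + 1))` on the curve `y ^ 2 = x ^ (k + 1)`. -/
def arc (k : ℕ) (ε : ℤˣ) (t : ℂ) : Fin 2 → ℂ := ![t ^ 2, ((ε : ℤ) : ℂ) * t ^ (k + 1)]

lemma continuous_arc (k : ℕ) (ε : ℤˣ) : Continuous (arc k ε) := by
  unfold arc
  refine continuous_pi fun i => ?_
  fin_cases i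
  · simp only [Fin.zero_eta, Matrix.cons_val_zero]; fun_prop
  · simp only [Fin.mk_one, Matrix.cons_val_one, Matrix.cons_val_fin_one]; fun_prop

@[simp] lemma arc_zero (k : ℕ) (ε : ℤˣ) : arc k ε 0 = 0 := by
  ext i
  fin_cases i <;> simp [arc]

lemma norm_unit_cast (ε : ℤˣ) : ‖((ε : ℤ) : ℂ)‖ = 1 := by
  rcases Int.units_eq_one_or ε with rfl | rfl <;> simp

lemma arc_isBigO (k : ℕ) (ε : ℤˣ) : arc k ε =O[𝓝 0] fun t : ℂ => t := by
  refine IsBigO.of_bound 1 ?_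
  filter_upwards [Metric.closedBall_mem_nhds (0 : ℂ) one_pos] with t ht
  have ht' : ‖t‖ ≤ 1 := by simpa using ht
  rw [one_mul, pi_norm_le_iff_of_nonneg (norm_nonneg _)]
  intro i
  fin_cases i
  · simpa [arc] using pow_le_of_le_one (norm_nonneg t) ht' two_ne_zero
  · change ‖((ε : ℤ) : ℂ) * t ^ (k + 1)‖ ≤ ‖t‖
    rw [norm_mul, norm_unit_cast, one_mul, norm_pow]
    exact pow_le_of_le_one (norm_nonneg t) ht' (Nat.succ_ne_zero k)

lemma continuousAt_comp_arc {φ : (Fin 2 → ℂ) → Fin 2 → ℂ} (hφ : ContinuousAt φ 0) (k : ℕ)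
    (ε : ℤˣ) : ContinuousAt (fun t => φ (arc k ε t)) 0 := by
  have h : ContinuousAt φ (arc k ε 0) := by rwa [arc_zero]
  exact ContinuousAt.comp (f := arc k ε) h (continuous_arc k ε).continuousAt

/-- The polynomials that vanish to order at least `2 n` along the images under `φ` of both arcs. -/
noncomputable def branchIdeal (φ : (Fin 2 → ℂ) → Fin 2 → ℂ) (hφ : ContinuousAt φ 0) (k n : ℕ) :
    Ideal (MvPolynomial (Fin 2) ℂ) :=
  ⨅ ε : ℤˣ, contactIdeal (fun t => φ (arc k ε t)) (continuousAt_comp_arc hφ k ε) (2 * n)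

lemma mem_branchIdeal {φ : (Fin 2 → ℂ) → Fin 2 → ℂ} {hφ : ContinuousAt φ 0} {k n : ℕ}
    {P : MvPolynomial (Fin 2) ℂ} :
    P ∈ branchIdeal φ hφ k n ↔
      ∀ ε : ℤˣ, (fun t => eval (φ (arc k ε t)) P) =O[𝓝 0] fun t : ℂ => t ^ (2 * n) := by
  simp [branchIdeal, mem_contactIdeal]

lemma mul_mem_branchIdeal {φ : (Fin 2 → ℂ) → Fin 2 → ℂ} {hφ : ContinuousAt φ 0} {k n n' : ℕ}
    {P Q : MvPolynomial (Fin 2) ℂ} (hP : P ∈ branchIdeal φ hφ k n)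
    (hQ : Q ∈ branchIdeal φ hφ k n') : P * Q ∈ branchIdeal φ hφ k (n + n') := by
  rw [mem_branchIdeal] at *
  intro ε
  simpa [mul_add, pow_add] using (hP ε).mul (hQ ε)

/-! ### The branch ideals of the model curve -/

/-- The monomials `x ^ i` with `i < n` and `x ^ j * y` with `j < n - (k + 1) / 2`. -/
noncomputable def branchMonomial (k n : ℕ) :
    Fin n ⊕ Fin (n - (k + 1) / 2) → MvPolynomial (Fin 2) ℂ :=
  Sum.elim (fun i => X 0 ^ (i : ℕ)) fun j => X 0 ^ (j : ℕ) * X 1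

lemma eval_arc_zero (k : ℕ) (ε : ℤˣ) (t : ℂ) : arc k ε t 0 = t ^ 2 := rfl

lemma eval_arc_one (k : ℕ) (ε : ℤˣ) (t : ℂ) : arc k ε t 1 = ((ε : ℤ) : ℂ) * t ^ (k + 1) := rfl

lemma unit_cast_sq (ε : ℤˣ) : ((ε : ℤ) : ℂ) ^ 2 = 1 := by
  rcases Int.units_eq_one_or ε with rfl | rfl <;> simp

/-- Half the sum and half the difference over the two arcs separate the part free of y from the part
linear in y. In each, the powers of t are distinct and below 2n. The argument is the same whether
the curve has one branch (k even) or two (k odd). -/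
lemma branchMonomial_independent {k n : ℕ} {c : Fin n ⊕ Fin (n - (k + 1) / 2) → ℂ}
    (h : ∑ i, c i • branchMonomial k n i ∈ branchIdeal id continuousAt_id k n) : c = 0 := by
  rw [mem_branchIdeal] at h
  have e : ∀ (ε : ℤˣ) (t : ℂ), eval (id (arc k ε t)) (∑ i, c i • branchMonomial k n i)
      = (∑ i, c (Sum.inl i) * t ^ (2 * (i : ℕ))) +
        ((ε : ℤ) : ℂ) * ∑ j, c (Sum.inr j) * t ^ (2 * (j : ℕ) + (k + 1)) := by
    intro ε t
    simp only [branchMonomial, Fintype.sum_sum_type, Sum.elim_inl, Sum.elim_inr, map_add, map_sum,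
      smul_eval, map_mul, map_pow, eval_X, id, eval_arc_zero, eval_arc_one, Finset.mul_sum]
    congr 1
    · exact Finset.sum_congr rfl fun i _ => by rw [pow_mul]
    · exact Finset.sum_congr rfl fun i _ => by ring
  have h1 := h 1
  have h2 := h (-1)
  simp only [e] at h1 h2
  funext i
  rcases i with i | j
  · refine eq_zero_of_sum_isBigO (N := 2 * n) (e := fun i : Fin n => 2 * (i : ℕ)) ?_ ?_
      (c := fun i => c (Sum.inl i)) ?_ i
    · intro i j hij; ext; simpa using hij
    · intro i; have := i.2; omega
    · refine ((h1.add h2).const_mul_left (1 / 2)).congr_left fun t => ?_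
      push_cast; ring
  · refine eq_zero_of_sum_isBigO (N := 2 * n)
      (e := fun j : Fin (n - (k + 1) / 2) => 2 * (j : ℕ) + (k + 1)) ?_ ?_
      (c := fun i => c (Sum.inr i)) ?_ j
    · intro i j hij; ext; simpa using hij
    · intro i; have := i.2; omega
    · refine ((h1.sub h2).const_mul_left (1 / 2)).congr_left fun t => ?_
      push_cast; ring

lemma pow_isBigO_pow {m n : ℕ} (h : n ≤ m) : (fun t : ℂ => t ^ m) =O[𝓝 0] fun t => t ^ n := by
  refine IsBigO.of_bound 1 ?_
  filter_upwards [Metric.closedBall_mem_nhds (0 : ℂ) one_pos] with t ht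
  have ht' : ‖t‖ ≤ 1 := by simpa using ht
  rw [one_mul, norm_pow, norm_pow]
  exact pow_le_pow_of_le_one (norm_nonneg _) ht' h

/-- Since y² = x^(k+1) on both arcs, every monomial reduces to some x^i or x^i y; those outside the
list already vanish to order 2n. -/
lemma span_branchMonomial_sup (k n : ℕ) :
    Submodule.span ℂ (Set.range (branchMonomial k n)) ⊔
      (branchIdeal id continuousAt_id k n).restrictScalars ℂ = ⊤ := by
  rw [eq_top_iff]
  set S := Submodule.span ℂ (Set.range (branchMonomial k n)) ⊔
      (branchIdeal id continuousAt_id k n).restrictScalars ℂ with hS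
  have hJ : ∀ P ∈ branchIdeal id continuousAt_id k n, P ∈ S := fun P hP =>
    (le_sup_right : _ ≤ S) hP
  have h0 : ∀ i : ℕ, (X 0 ^ i : MvPolynomial (Fin 2) ℂ) ∈ S := by
    intro i
    by_cases hi : i < n
    · exact (le_sup_left : _ ≤ S) (Submodule.subset_span ⟨Sum.inl ⟨i, hi⟩, rfl⟩)
    · refine hJ _ (mem_branchIdeal.mpr fun ε => ?_)
      simp only [map_pow, eval_X, id, eval_arc_zero, ← pow_mul]
      exact pow_isBigO_pow (by omega)
  have h1 : ∀ i : ℕ, (X 0 ^ i * X 1 : MvPolynomial (Fin 2) ℂ) ∈ S := by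
    intro i
    by_cases hi : i < n - (k + 1) / 2
    · exact (le_sup_left : _ ≤ S) (Submodule.subset_span ⟨Sum.inr ⟨i, hi⟩, rfl⟩)
    · refine hJ _ (mem_branchIdeal.mpr fun ε => ?_)
      have : (fun t => eval (id (arc k ε t)) (X 0 ^ i * X 1 : MvPolynomial (Fin 2) ℂ))
          = fun t => ((ε : ℤ) : ℂ) * t ^ (2 * i + (k + 1)) := by
        funext t
        simp only [map_pow, map_mul, eval_X, id, eval_arc_zero, eval_arc_one, ← pow_mul, pow_add]
        ring
      rw [this]
      exact (pow_isBigO_pow (by omega)).const_mul_left _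
  intro P _
  induction P using MvPolynomial.induction_on' with
  | add p q hp hq => exact S.add_mem (hp trivial) (hq trivial)
  | monomial e c =>
    have hm : monomial e c = c • (X 0 ^ e 0 * X 1 ^ e 1 : MvPolynomial (Fin 2) ℂ) := by
      rw [monomial_eq, Finsupp.prod_fintype _ _ (fun i => pow_zero _), smul_eq_C_mul]
      simp
    rw [hm]
    refine S.smul_mem c ?_
    have hred : ∀ (i l b : ℕ), (X 0 ^ i * X 1 ^ (2 * l + b) -
        X 0 ^ (i + (k + 1) * l) * X 1 ^ b : MvPolynomial (Fin 2) ℂ) ∈ S := by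
      intro i l b
      refine hJ _ (mem_branchIdeal.mpr fun ε => ?_)
      refine (isBigO_zero _ _).congr_left fun t => ?_
      simp only [map_pow, map_mul, map_sub, eval_X, id, eval_arc_zero, eval_arc_one]
      rw [pow_add _ (2 * l) b, pow_mul _ 2 l, mul_pow _ _ 2, unit_cast_sq]
      ring
    rcases Nat.even_or_odd' (e 1) with ⟨l, hl | hl⟩
    · rw [hl]
      have := S.add_mem (hred (e 0) l 0) (h0 (e 0 + (k + 1) * l))
      simpa using this
    · rw [hl]
      have := S.add_mem (hred (e 0) l 1) (h1 (e 0 + (k + 1) * l))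
      simpa using this

/-! ### The branch ideals at a singularity of type `A_k` -/

/-- `P` and `Q` agree to order `2 n` along both arcs, `P` being pulled back by `φ`. -/
def Agree (φ : (Fin 2 → ℂ) → Fin 2 → ℂ) (k n : ℕ) (P Q : MvPolynomial (Fin 2) ℂ) : Prop :=
  ∀ ε : ℤˣ, (fun t => eval (φ (arc k ε t)) P - eval (arc k ε t) Q) =O[𝓝 0]
    fun t : ℂ => t ^ (2 * n)

lemma Agree.sub {φ : (Fin 2 → ℂ) → Fin 2 → ℂ} {k n : ℕ} {P Q P' Q' : MvPolynomial (Fin 2) ℂ}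
    (h : Agree φ k n P Q) (h' : Agree φ k n P' Q') : Agree φ k n (P - P') (Q - Q') := fun ε => by
  refine ((h ε).sub (h' ε)).congr_left fun t => ?_
  simp only [map_sub]
  ring

lemma Agree.sum_smul {ι : Type*} {φ : (Fin 2 → ℂ) → Fin 2 → ℂ} {k n : ℕ}
    {P Q : ι → MvPolynomial (Fin 2) ℂ} (h : ∀ i, Agree φ k n (P i) (Q i)) (s : Finset ι)
    (c : ι → ℂ) : Agree φ k n (∑ i ∈ s, c i • P i) (∑ i ∈ s, c i • Q i) := fun ε => by
  have := IsBigO.sum (s := s) fun i _ => ((h i ε).const_mul_left (c i))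
  refine this.congr_left fun t => ?_
  simp only [map_sum, smul_eval, ← Finset.sum_sub_distrib, mul_sub, Finset.sum_apply]

lemma Agree.mem_iff {φ : (Fin 2 → ℂ) → Fin 2 → ℂ} {hφ : ContinuousAt φ 0} {k n : ℕ}
    {P Q : MvPolynomial (Fin 2) ℂ} (h : Agree φ k n P Q) :
    P ∈ branchIdeal φ hφ k n ↔ Q ∈ branchIdeal id continuousAt_id k n := by
  rw [mem_branchIdeal, mem_branchIdeal]
  refine ⟨fun hP ε => ?_, fun hQ ε => ?_⟩
  · refine ((hP ε).sub (h ε)).congr_left fun t => ?_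
    simp
  · refine ((hQ ε).add (h ε)).congr_left fun t => ?_
    simp

/-- Agreement to order 2n preserves membership and linear combinations, so the basis of the model
quotient can be transported without a ring map between the quotients. -/
lemma finrank_quotient_branchIdeal_of_agree {φ : (Fin 2 → ℂ) → Fin 2 → ℂ} {hφ : ContinuousAt φ 0}
    {k n : ℕ} (h₁ : ∀ P, ∃ Q, Agree φ k n P Q) (h₂ : ∀ Q, ∃ P, Agree φ k n P Q) :
    Module.Finite ℂ (MvPolynomial (Fin 2) ℂ ⧸ branchIdeal φ hφ k n) ∧
      Module.finrank ℂ (MvPolynomial (Fin 2) ℂ ⧸ branchIdeal φ hφ k n)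
        = n + (n - (k + 1) / 2) := by
  choose p hp using fun i => h₂ (branchMonomial k n i)
  set J := branchIdeal φ hφ k n
  have hli : LinearIndependent ℂ fun i => Ideal.Quotient.mkₐ ℂ J (p i) := by
    rw [Fintype.linearIndependent_iff]
    intro c hc
    have hc' : Ideal.Quotient.mkₐ ℂ J (∑ i, c i • p i) = 0 := by
      simpa only [map_sum, map_smul] using hc
    rw [Ideal.Quotient.mkₐ_eq_mk, Ideal.Quotient.eq_zero_iff_mem,
      (Agree.sum_smul hp Finset.univ c).mem_iff] at hc'
    exact fun i => congrFun (branchMonomial_independent hc') i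
  have hsp : ⊤ ≤ Submodule.span ℂ (Set.range fun i => Ideal.Quotient.mkₐ ℂ J (p i)) := by
    intro x _
    obtain ⟨P, rfl⟩ := Ideal.Quotient.mkₐ_surjective ℂ J x
    obtain ⟨Q, hQ⟩ := h₁ P
    have hQS : Q ∈ (⊤ : Submodule ℂ (MvPolynomial (Fin 2) ℂ)) := trivial
    rw [← span_branchMonomial_sup k n, Submodule.mem_sup] at hQS
    obtain ⟨Q₁, hQ₁, Q₂, hQ₂, hsum⟩ := hQS
    obtain ⟨c, hc⟩ := (Submodule.mem_span_range_iff_exists_fun ℂ).mp hQ₁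
    have hmem : P - ∑ i, c i • p i ∈ J := by
      rw [(hQ.sub (Agree.sum_smul hp Finset.univ c)).mem_iff, hc, ← hsum, add_sub_cancel_left]
      exact hQ₂
    have : Ideal.Quotient.mkₐ ℂ J P = ∑ i, c i • Ideal.Quotient.mkₐ ℂ J (p i) := by
      have := (Ideal.Quotient.eq (I := J)).mpr hmem
      rw [← Ideal.Quotient.mkₐ_eq_mk ℂ] at this
      rw [this]
      simp only [map_sum, map_smul]
    rw [this]
    exact (Submodule.mem_span_range_iff_exists_fun ℂ).mpr ⟨c, rfl⟩
  let b := Module.Basis.mk hli hsp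
  refine ⟨Module.Finite.of_basis b, ?_⟩
  rw [Module.finrank_eq_card_basis b]
  simp

/-- A decreasing multiplicative filtration of the polynomial ring by ideals containing `F` whose
`n`-th member has codimension `n + (n - δ)`. -/
structure IsBranchFiltration (F : MvPolynomial (Fin 2) ℂ) (δ : ℕ)
    (J : ℕ → Ideal (MvPolynomial (Fin 2) ℂ)) : Prop where
  mem : ∀ n, F ∈ J n
  mul_mem : ∀ {n n' P Q}, P ∈ J n → Q ∈ J n' → P * Q ∈ J (n + n')
  anti : Antitone J
  finite : ∀ n, Module.Finite ℂ (MvPolynomial (Fin 2) ℂ ⧸ J n)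
  finrank_eq : ∀ n, Module.finrank ℂ (MvPolynomial (Fin 2) ℂ ⧸ J n) = n + (n - δ)

/-- The two transport hypotheses come from Taylor polynomials of P ∘ χ⁻¹ at 0 and of Q ∘ χ at p. -/
theorem exists_isBranchFiltration {F : MvPolynomial (Fin 2) ℂ} {k : ℕ} {p : Fin 2 → ℂ}
    (hp : HasSingularityA F k p) :
    ∃ J, IsBranchFiltration F ((k + 1) / 2) J := by
  obtain ⟨χ, w, hps, hp0, hχ, hχ', hw, hw0, hF⟩ := hp
  have h0t : (0 : Fin 2 → ℂ) ∈ χ.target := hp0 ▸ χ.map_source hps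
  have hsymm0 : χ.symm 0 = p := by rw [← hp0, χ.left_inv hps]
  have han : AnalyticAt ℂ χ.symm 0 := hχ' 0 h0t
  have hcont : ContinuousAt χ.symm 0 := han.continuousAt
  have harc : ∀ ε, Tendsto (arc k ε) (𝓝 0) (𝓝 0) := fun ε => by
    simpa using (continuous_arc k ε).tendsto 0
  have hsarc : ∀ ε, Tendsto (fun t => χ.symm (arc k ε t)) (𝓝 0) (𝓝 p) := fun ε => by
    have := hcont.tendsto.comp (harc ε)
    rwa [hsymm0] at this
  have hfin := fun n => finrank_quotient_branchIdeal_of_agree (hφ := hcont) (k := k) (n := n)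
    (fun P => ?_) fun Q => ?_
  · refine ⟨branchIdeal χ.symm hcont k, fun n => mem_branchIdeal.mpr fun ε => ?_,
      mul_mem_branchIdeal, fun n n' hn P hP => mem_branchIdeal.mpr fun ε => ?_,
      fun n => (hfin n).1, fun n => (hfin n).2⟩
    -- The factor y² - x^(k+1) is zero on the arcs, so F vanishes identically on their images near t
    -- = 0.
    · refine (isBigO_zero (E' := ℂ) (fun t : ℂ => t ^ (2 * n)) (𝓝 0)).congr' ?_ EventuallyEq.rfl
      filter_upwards [(hsarc ε).eventually hF,
        (harc ε).eventually (χ.open_target.mem_nhds h0t)] with t ht htt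
      rw [ht, χ.right_inv htt, eval_arc_zero, eval_arc_one, mul_pow, unit_cast_sq]
      ring
    · exact (mem_branchIdeal.mp hP ε).trans (pow_isBigO_pow (by omega))
  · have hP : AnalyticAt ℂ (fun z => eval (χ.symm z) P) 0 := by
      have : AnalyticAt ℂ (fun z => eval z P) (χ.symm 0) :=
        AnalyticOnNhd.eval_mvPolynomial P _ trivial
      exact this.comp han
    obtain ⟨Q, hQ⟩ := exists_taylor_polynomial hP (2 * n)
    refine ⟨Q, fun ε => (hQ.comp_tendsto (harc ε)).trans ?_⟩
    simpa [Function.comp_def] using ((arc_isBigO k ε).norm_left).pow (2 * n)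
  · have hQ : AnalyticAt ℂ (fun z => eval (χ z) Q) p := by
      have : AnalyticAt ℂ (fun z => eval z Q) (χ p) :=
        AnalyticOnNhd.eval_mvPolynomial Q _ trivial
      exact this.comp (hχ p hps)
    obtain ⟨P, hP⟩ := exists_taylor_polynomial hQ (2 * n)
    refine ⟨P, fun ε => ?_⟩
    -- The image arc approaches p at least linearly in t, which turns the Taylor error at p into
    -- O(t^(2n)).
    have h1 : (fun t => χ.symm (arc k ε t) - p) =O[𝓝 0] fun t : ℂ => t := by
      have := (han.differentiableAt.isBigO_sub).comp_tendsto (harc ε)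
      rw [hsymm0] at this
      refine IsBigO.trans this ?_
      simpa [Function.comp_def] using arc_isBigO k ε
    have h2 := ((hP.comp_tendsto (hsarc ε)).trans (by
      simpa [Function.comp_def] using (h1.norm_left).pow (2 * n))).neg_left
    refine h2.congr' ?_ EventuallyEq.rfl
    filter_upwards [(harc ε).eventually (χ.open_target.mem_nhds h0t)] with t htt
    simp [χ.right_inv htt]

end HirzebruchCurve

/-! ### Global part: normal forms modulo F, weighted Bezout and the counting inequality. -/

namespace HirzebruchCurve

open MvPolynomial
open scoped Pointwise

/-! ### Polynomials of bounded weight -/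

/-- The exponents of weight at most `d`, the variables `x` and `y` having weights `b` and `a`. -/
def weightSet (a b d : ℕ) : Set (Fin 2 →₀ ℕ) := {e | b * e 0 + a * e 1 ≤ d}

/-- The exponents of weight at most `d` and of degree less than `a` in `x`. -/
def boxSet (a b d : ℕ) : Set (Fin 2 →₀ ℕ) := {e | e 0 < a ∧ b * e 0 + a * e 1 ≤ d}

lemma boxSet_subset_weightSet (a b d : ℕ) : boxSet a b d ⊆ weightSet a b d := fun _ he => he.2

lemma mul_mem_restrictSupport {s t u : Set (Fin 2 →₀ ℕ)} (h : ∀ e ∈ s, ∀ f ∈ t, e + f ∈ u)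
    {P Q : MvPolynomial (Fin 2) ℂ} (hP : P ∈ restrictSupport ℂ s) (hQ : Q ∈ restrictSupport ℂ t) :
    P * Q ∈ restrictSupport ℂ u := by
  have : P * Q ∈ restrictSupport ℂ (s + t) := by
    rw [restrictSupport_add]
    exact Submodule.mul_mem_mul hP hQ
  refine restrictSupport_mono ℂ ?_ this
  rintro _ ⟨e, he, f, hf, rfl⟩
  exact h e he f hf

lemma mul_mem_weightSet {a b d d' : ℕ} {P Q : MvPolynomial (Fin 2) ℂ}
    (hP : P ∈ restrictSupport ℂ (weightSet a b d))
    (hQ : Q ∈ restrictSupport ℂ (weightSet a b d')) :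
    P * Q ∈ restrictSupport ℂ (weightSet a b (d + d')) := by
  refine mul_mem_restrictSupport (fun e he f hf => ?_) hP hQ
  simp only [weightSet, Set.mem_ofPred_eq, Finsupp.add_apply, mul_add] at *
  omega

lemma pow_mem_weightSet {a b d : ℕ} {P : MvPolynomial (Fin 2) ℂ}
    (hP : P ∈ restrictSupport ℂ (weightSet a b d)) (n : ℕ) :
    P ^ n ∈ restrictSupport ℂ (weightSet a b (n * d)) := by
  induction n with
  | zero =>
    rw [pow_zero, ← C_1, C_apply, monomial_mem_restrictSupport]
    left
    simp [weightSet]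
  | succ n ih =>
    rw [pow_succ, add_mul, one_mul]
    exact mul_mem_weightSet ih hP

lemma exists_mem_weightSet (a b : ℕ) (P : MvPolynomial (Fin 2) ℂ) :
    ∃ d, P ∈ restrictSupport ℂ (weightSet a b d) :=
  ⟨P.support.sup fun e => b * e 0 + a * e 1, fun _ he =>
    Finset.le_sup (f := fun e : Fin 2 →₀ ℕ => b * e 0 + a * e 1) he⟩

lemma weightSet_mono {a b d d' : ℕ} (h : d ≤ d') : weightSet a b d ⊆ weightSet a b d' :=
  fun _ he => le_trans he h

/-- The exponent of `x ^ i * y ^ j`. -/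
noncomputable def expo (i j : ℕ) : Fin 2 →₀ ℕ := Finsupp.single 0 i + Finsupp.single 1 j

@[simp] lemma expo_apply_zero (i j : ℕ) : expo i j 0 = i := by simp [expo]

@[simp] lemma expo_apply_one (i j : ℕ) : expo i j 1 = j := by simp [expo]

lemma expo_eta (e : Fin 2 →₀ ℕ) : expo (e 0) (e 1) = e := by
  ext i
  fin_cases i <;> simp

lemma boxSet_eq_image {a b d : ℕ} (ha : 1 ≤ a) (hd : a * b ≤ d) :
    boxSet a b d = (fun s : Σ _ : ℕ, ℕ => expo s.1 s.2) ''
      ((Finset.range a).sigma fun i => Finset.range ((d - b * i) / a + 1) : Finset (Σ _ : ℕ, ℕ)) := by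
  ext e
  have key : ∀ i j, i < a → (b * i + a * j ≤ d ↔ j < (d - b * i) / a + 1) := by
    intro i j hi
    have : b * i ≤ d := (Nat.mul_le_mul_left b hi.le).trans ((mul_comm b a).le.trans hd)
    rw [Nat.lt_succ_iff, Nat.le_div_iff_mul_le ha, mul_comm j a]
    omega
  simp only [boxSet, Set.mem_ofPred_eq, Set.mem_image, Finset.mem_coe, Finset.mem_sigma,
    Finset.mem_range]
  constructor
  · rintro ⟨h0, h1⟩
    exact ⟨⟨e 0, e 1⟩, ⟨h0, (key _ _ h0).mp h1⟩, expo_eta e⟩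
  · rintro ⟨⟨i, j⟩, ⟨hi, hj⟩, rfl⟩
    simp only [expo_apply_zero, expo_apply_one]
    exact ⟨hi, (key _ _ hi).mpr hj⟩

lemma expo_injective : Function.Injective fun s : Σ _ : ℕ, ℕ => expo s.1 s.2 := by
  rintro ⟨i, j⟩ ⟨i', j'⟩ h
  have h0 := DFunLike.congr_fun h 0
  have h1 := DFunLike.congr_fun h 1
  simp only [expo_apply_zero, expo_apply_one] at h0 h1
  subst h0 h1
  rfl

lemma finite_boxSet {a b d : ℕ} (ha : 1 ≤ a) (hd : a * b ≤ d) : (boxSet a b d).Finite := by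
  rw [boxSet_eq_image ha hd]
  exact (Finset.finite_toSet _).image _

/-- When ab ≤ d, no column i < a is truncated, so each of the a columns gains exactly s exponents.
-/
lemma ncard_boxSet_add {a b d : ℕ} (ha : 1 ≤ a) (hd : a * b ≤ d) (s : ℕ) :
    (boxSet a b (d + a * s)).ncard = (boxSet a b d).ncard + a * s := by
  have hcard : ∀ d, a * b ≤ d →
      (boxSet a b d).ncard = ∑ i ∈ Finset.range a, ((d - b * i) / a + 1) := by
    intro d hd
    rw [boxSet_eq_image ha hd, Set.ncard_image_of_injective _ expo_injective,
      Set.ncard_coe_finset, Finset.card_sigma]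
    simp
  rw [hcard _ hd, hcard _ (by omega)]
  have : a * s = ∑ i ∈ Finset.range a, s := by simp
  conv_rhs => rw [this]
  rw [← Finset.sum_add_distrib]
  refine Finset.sum_congr rfl fun i hi => ?_
  have : b * i ≤ d := (Nat.mul_le_mul_left b (Finset.mem_range.mp hi).le).trans
    ((mul_comm b a).le.trans hd)
  rw [show d + a * s - b * i = (d - b * i) + a * s by omega, Nat.add_mul_div_left _ _ ha]
  omega

/-! ### Reduction modulo a polynomial that is monic in `x` -/

section Reduction

variable {F : MvPolynomial (Fin 2) ℂ} {a b : ℕ}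

/-- Division by F in x: among exponents of weight at most ab, only that of x^a has x-degree at least
a. Hence x^a can be traded modulo F for terms of smaller x-degree and no larger weight. -/
lemma monomial_mem_box_sup (hc : coeff (expo a 0) F ≠ 0) (ha : 1 ≤ a) (hb : 1 ≤ b)
    (hwt : F ∈ restrictSupport ℂ (weightSet a b (a * b))) (d n : ℕ) :
    restrictSupport ℂ (weightSet a b d ∩ {e | e 0 < a + n}) ≤
      restrictSupport ℂ (boxSet a b d) ⊔ (Ideal.span {F}).restrictScalars ℂ := by
  induction n with
  | zero =>
    refine le_trans (restrictSupport_mono ℂ ?_) le_sup_left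
    rintro e ⟨h1, h2⟩
    exact ⟨h2, h1⟩
  | succ n ih =>
    rw [restrictSupport_eq_span ℂ, Submodule.span_le]
    rintro _ ⟨e, ⟨hed, hen⟩, rfl⟩
    simp only [Set.mem_ofPred_eq] at hen
    by_cases hlt : e 0 < a + n
    · exact ih ((monomial_mem_restrictSupport ℂ).mpr (Or.inl ⟨hed, hlt⟩))
    set c := coeff (expo a 0) F
    set e' := expo (e 0 - a) (e 1)
    have hee' : e' + expo a 0 = e := by
      ext i
      fin_cases i
      · simp only [Fin.zero_eta, Finsupp.add_apply, e', expo_apply_zero]; omega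
      · simp [e']
    have hR : F - monomial (expo a 0) c ∈
        restrictSupport ℂ (weightSet a b (a * b) ∩ {e | e 0 < a}) := by
      rw [mem_restrictSupport_iff]
      intro f hf
      have hf' : coeff f F - coeff f (monomial (expo a 0) c) ≠ 0 := by
        simpa [mem_support_iff] using hf
      rw [coeff_monomial] at hf'
      have hne : expo a 0 ≠ f := by
        rintro rfl
        simp [c] at hf'
      rw [if_neg hne, sub_zero] at hf'
      have hfw := hwt (mem_support_iff.mpr hf')
      refine ⟨hfw, ?_⟩
      simp only [weightSet, Set.mem_ofPred_eq] at hfw ⊢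
      by_contra hge
      have hle : f 0 ≤ a := by
        have : b * f 0 ≤ b * a := by rw [mul_comm b a]; omega
        exact Nat.le_of_mul_le_mul_left this hb
      have h0 : f 0 = a := by omega
      have h1 : f 1 = 0 := by
        rw [h0, mul_comm b a] at hfw
        have : a * f 1 = 0 := by omega
        rcases Nat.mul_eq_zero.mp this with h | h <;> omega
      exact hne (by rw [← expo_eta f, h0, h1])
    have hsplit : monomial e (1 : ℂ) =
        monomial e' c⁻¹ * F - monomial e' c⁻¹ * (F - monomial (expo a 0) c) := by
      rw [← mul_sub, sub_sub_cancel, monomial_mul, hee', inv_mul_cancel₀ hc]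
    rw [SetLike.mem_coe]
    dsimp only
    rw [hsplit]
    refine Submodule.sub_mem _ (Submodule.mem_sup_right ?_) (ih ?_)
    · exact Ideal.mul_mem_left _ _ (Ideal.mem_span_singleton_self F)
    · refine mul_mem_restrictSupport (s := {e'}) ?_
        ((monomial_mem_restrictSupport ℂ).mpr (Or.inl rfl)) hR
      rintro _ rfl f ⟨hf1, hf2⟩
      simp only [weightSet, Set.mem_ofPred_eq, Set.mem_inter_iff, Finsupp.add_apply, e',
        expo_apply_zero, expo_apply_one, mul_add] at *
      have : b * (e 0 - a) + b * a = b * e 0 := by rw [← mul_add]; congr 1; omega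
      rw [mul_comm a b] at hf1
      omega

lemma exists_reduction (hc : coeff (expo a 0) F ≠ 0) (ha : 1 ≤ a) (hb : 1 ≤ b)
    (hwt : F ∈ restrictSupport ℂ (weightSet a b (a * b))) {d : ℕ} {P : MvPolynomial (Fin 2) ℂ}
    (hP : P ∈ restrictSupport ℂ (weightSet a b d)) :
    ∃ Q ∈ restrictSupport ℂ (boxSet a b d), F ∣ P - Q := by
  -- Since b ≥ 1, weight at most d forces x-degree at most d.
  have h : P ∈ restrictSupport ℂ (weightSet a b d ∩ {e | e 0 < a + (d + 1)}) := by
    refine restrictSupport_mono ℂ ?_ hP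
    intro e he
    refine ⟨he, ?_⟩
    simp only [weightSet, Set.mem_ofPred_eq] at *
    have : e 0 ≤ b * e 0 := Nat.le_mul_of_pos_left _ hb
    omega
  obtain ⟨Q, hQ, S, hS, rfl⟩ := Submodule.mem_sup.mp (monomial_mem_box_sup hc ha hb hwt d _ h)
  refine ⟨Q, hQ, ?_⟩
  rw [add_sub_cancel_left]
  exact Ideal.mem_span_singleton.mp hS

/-- The x-degree is additive, so a nonzero multiple of F has x-degree at least a. -/
lemma eq_zero_of_dvd_of_mem_box (hc : coeff (expo a 0) F ≠ 0) {d : ℕ}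
    {P : MvPolynomial (Fin 2) ℂ} (hP : P ∈ restrictSupport ℂ (boxSet a b d)) (h : F ∣ P) :
    P = 0 := by
  by_contra hP0
  obtain ⟨Q, rfl⟩ := h
  have hF0 : F ≠ 0 := left_ne_zero_of_mul hP0
  have hQ0 : Q ≠ 0 := right_ne_zero_of_mul hP0
  have h1 : a ≤ degreeOf 0 F := by
    simpa using monomial_le_degreeOf 0 (mem_support_iff.mpr hc)
  have h2 := degreeOf_mul_eq (n := (0 : Fin 2)) hF0 hQ0
  obtain ⟨e, he⟩ := Finset.nonempty_iff_ne_empty.mpr (mt support_eq_empty.mp hP0)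
  have ha : 0 < a := lt_of_le_of_lt (Nat.zero_le _) (hP he).1
  have h3 : degreeOf 0 (F * Q) < a := (degreeOf_lt_iff ha).mpr fun e he => (hP he).1
  omega

end Reduction

lemma finrank_restrictSupport (s : Set (Fin 2 →₀ ℕ)) :
    Module.finrank ℂ (restrictSupport ℂ s) = s.ncard := by
  rw [Module.finrank_eq_nat_card_basis (basisRestrictSupport ℂ s), Nat.card_coe_set_eq]

lemma finite_restrictSupport {s : Set (Fin 2 →₀ ℕ)} (hs : s.Finite) :
    Module.Finite ℂ (restrictSupport ℂ s) :=
  have := hs.to_subtype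
  Module.Finite.of_basis (basisRestrictSupport ℂ s)

/-! ### Curves with a branch filtration -/

/-- `F` is irreducible, monic in `x` of degree `a` up to a constant, and its Newton polygon lies in
the triangle spanned by `(a, 0)`, `(0, 0)` and `(0, b)`. -/
structure IsMonicCurve (F : MvPolynomial (Fin 2) ℂ) (a b : ℕ) : Prop where
  prime : Prime F
  coeff_ne_zero : coeff (expo a 0) F ≠ 0
  one_le_a : 1 ≤ a
  one_le_b : 1 ≤ b
  mem_weightSet : F ∈ restrictSupport ℂ (weightSet a b (a * b))

section Curve

variable {F : MvPolynomial (Fin 2) ℂ} {a b δ : ℕ} {J : ℕ → Ideal (MvPolynomial (Fin 2) ℂ)}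

lemma IsBranchFiltration.pow_mem (hJ : IsBranchFiltration F δ J) {M : ℕ}
    {G : MvPolynomial (Fin 2) ℂ} (hG : G ∈ J M) {n : ℕ} (hn : 1 ≤ n) : G ^ n ∈ J (n * M) := by
  induction n, hn using Nat.le_induction with
  | base => simpa using hG
  | succ n hn ih =>
    rw [pow_succ, add_mul, one_mul]
    exact hJ.mul_mem ih hG

/-- The linear map from the polynomials with exponents in `s` to the quotient by `I`. -/
noncomputable def supportToQuotient (s : Set (Fin 2 →₀ ℕ)) (I : Ideal (MvPolynomial (Fin 2) ℂ)) :
    restrictSupport ℂ s →ₗ[ℂ] MvPolynomial (Fin 2) ℂ ⧸ I :=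
  (Ideal.Quotient.mkₐ ℂ I).toLinearMap ∘ₗ (restrictSupport ℂ s).subtype

lemma supportToQuotient_apply (s : Set (Fin 2 →₀ ℕ)) (I : Ideal (MvPolynomial (Fin 2) ℂ))
    (P : restrictSupport ℂ s) :
    supportToQuotient s I P = Ideal.Quotient.mk I (P : MvPolynomial (Fin 2) ℂ) := rfl

/-- Finitely many generators have representatives of bounded weight, and these reduce into the box
because F lies in I. -/
lemma exists_surjective_of_finite (hF : IsMonicCurve F a b) {I : Ideal (MvPolynomial (Fin 2) ℂ)}
    (hI : F ∈ I) [Module.Finite ℂ (MvPolynomial (Fin 2) ℂ ⧸ I)] :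
    ∃ N, ∀ d, N ≤ d → Function.Surjective (supportToQuotient (boxSet a b d) I) := by
  obtain ⟨S, hS⟩ := Module.Finite.fg_top (R := ℂ) (M := MvPolynomial (Fin 2) ℂ ⧸ I)
  choose P hP using Ideal.Quotient.mk_surjective (I := I)
  choose D hD using exists_mem_weightSet a b
  refine ⟨S.sup fun x => D (P x), fun d hd => ?_⟩
  rw [← LinearMap.range_eq_top, eq_top_iff, ← hS, Submodule.span_le]
  intro x hx
  have hx' : P x ∈ restrictSupport ℂ (weightSet a b d) :=
    restrictSupport_mono ℂ (weightSet_mono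
      ((Finset.le_sup (f := fun x => D (P x)) hx).trans hd)) (hD (P x))
  obtain ⟨Q, hQ, hdvd⟩ :=
    exists_reduction hF.coeff_ne_zero hF.one_le_a hF.one_le_b hF.mem_weightSet hx'
  refine ⟨⟨Q, hQ⟩, ?_⟩
  rw [supportToQuotient_apply, ← hP x, eq_comm, Ideal.Quotient.eq]
  exact I.mem_of_dvd hdvd hI

/-- A weak form of Bezout's theorem. -/
lemma finrank_quotient_le (hF : IsMonicCurve F a b) {I : Ideal (MvPolynomial (Fin 2) ℂ)}
    (hI : F ∈ I) [Module.Finite ℂ (MvPolynomial (Fin 2) ℂ ⧸ I)] {G : MvPolynomial (Fin 2) ℂ}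
    (hG : G ∈ I) (hFG : ¬ F ∣ G) {s : ℕ}
    (hGs : G ∈ restrictSupport ℂ (weightSet a b (a * s))) :
    Module.finrank ℂ (MvPolynomial (Fin 2) ℂ ⧸ I) ≤ a * s := by
  obtain ⟨N₀, hN₀⟩ := exists_surjective_of_finite hF hI
  set N := max N₀ (a * b)
  have hN : a * b ≤ N := le_max_right _ _
  have hN' : a * b ≤ N + a * s := hN.trans (Nat.le_add_right _ _)
  have := finite_restrictSupport (finite_boxSet hF.one_le_a hN)
  have := finite_restrictSupport (finite_boxSet hF.one_le_a hN')
  set f := supportToQuotient (boxSet a b (N + a * s)) I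
  have hf : Function.Surjective f := hN₀ _ ((le_max_left _ _).trans (Nat.le_add_right _ _))
  set g := supportToQuotient (boxSet a b (N + a * s)) (Ideal.span {F})
  -- Multiplication by G embeds the normal forms of weight at most N into ℂ[x, y]/(F), landing in
  -- the classes of normal forms of weight at most N + as that lie in I. So the codimension of I is
  -- at most the difference of the two counts.
  set μ : restrictSupport ℂ (boxSet a b N) →ₗ[ℂ] MvPolynomial (Fin 2) ℂ ⧸ Ideal.span {F} :=
    LinearMap.mulRight ℂ (Ideal.Quotient.mk (Ideal.span {F}) G) ∘ₗ
      supportToQuotient (boxSet a b N) (Ideal.span {F})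
  have hμ_apply : ∀ P, μ P = Ideal.Quotient.mk (Ideal.span {F}) (P * G) := fun P => by
    simp [μ, supportToQuotient_apply]
  have hμ : Function.Injective μ := by
    rw [injective_iff_map_eq_zero]
    intro P hP
    rw [hμ_apply, Ideal.Quotient.eq_zero_iff_mem, Ideal.mem_span_singleton] at hP
    exact Subtype.ext (eq_zero_of_dvd_of_mem_box hF.coeff_ne_zero P.2
      ((hF.prime.dvd_or_dvd hP).resolve_right hFG))
  have hrange : LinearMap.range μ ≤ (LinearMap.ker f).map g := by
    rintro _ ⟨P, rfl⟩
    have hPG := mul_mem_weightSet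
      (restrictSupport_mono ℂ (boxSet_subset_weightSet a b N) P.2) hGs
    obtain ⟨Q, hQ, hdvd⟩ :=
      exists_reduction hF.coeff_ne_zero hF.one_le_a hF.one_le_b hF.mem_weightSet hPG
    refine ⟨⟨Q, hQ⟩, ?_, ?_⟩
    · rw [SetLike.mem_coe, LinearMap.mem_ker, supportToQuotient_apply,
        Ideal.Quotient.eq_zero_iff_mem]
      have h1 : (P : MvPolynomial (Fin 2) ℂ) * G ∈ I := I.mul_mem_left _ hG
      have h2 := I.mem_of_dvd hdvd hI
      simpa using I.sub_mem h1 h2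
    · rw [hμ_apply, supportToQuotient_apply, eq_comm, Ideal.Quotient.eq]
      exact Ideal.mem_span_singleton.mpr hdvd
  have h1 : Module.finrank ℂ (restrictSupport ℂ (boxSet a b N))
      ≤ Module.finrank ℂ (LinearMap.ker f) := by
    rw [← LinearMap.finrank_range_of_inj hμ]
    exact (Submodule.finrank_mono hrange).trans (Submodule.finrank_map_le g _)
  have h2 := LinearMap.finrank_range_add_finrank_ker f
  rw [LinearMap.range_eq_top.mpr hf, finrank_top, finrank_restrictSupport,
    ncard_boxSet_add hF.one_le_a hN] at h2
  rw [finrank_restrictSupport] at h1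
  omega

/-- Bezout is applied to a power G^n, which removes two defects: n is a multiple of a, so the weight
is one too, and n > δ, so the loss of δ in the codimension no longer matters. -/
lemma two_mul_le_of_mem (hF : IsMonicCurve F a b) (hJ : IsBranchFiltration F δ J) {d M : ℕ}
    {G : MvPolynomial (Fin 2) ℂ} (hG : G ∈ J M) (hFG : ¬ F ∣ G)
    (hGd : G ∈ restrictSupport ℂ (weightSet a b d)) : 2 * M ≤ d := by
  by_contra! hlt
  set n := a * (δ + 1) with hn
  have ha := hF.one_le_a
  have hn1 : 1 ≤ n := Nat.mul_pos ha (Nat.succ_pos δ)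
  have := hJ.finite (n * M)
  have h := finrank_quotient_le hF (hJ.mem (n * M)) (hJ.pow_mem hG hn1)
    (fun h => hFG (hF.prime.dvd_of_dvd_pow h)) (s := (δ + 1) * d)
    (by rw [← mul_assoc]; exact pow_mem_weightSet hGd n)
  rw [hJ.finrank_eq, ← mul_assoc, ← hn] at h
  have h1 : n * (d + 1) ≤ n * (2 * M) := Nat.mul_le_mul_left n hlt
  have h2 : δ + 1 ≤ n := Nat.le_mul_of_pos_left _ ha
  have h3 : n * (2 * M) = 2 * (n * M) := by ring
  rw [mul_add] at h1
  omega

lemma exists_factors (c : Fin 3 → ℂ) (hc : c ≠ 0) :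
    ∃ u v u' v' : ℂ, ¬ (u = 0 ∧ v = 0) ∧ ¬ (u' = 0 ∧ v' = 0) ∧ c 0 = u * u' ∧
      c 1 = u * v' + v * u' ∧ c 2 = v * v' := by
  by_cases h0 : c 0 = 0
  · refine ⟨0, 1, c 1, c 2, by simp, fun h => hc ?_, by simp [h0], by simp, by simp⟩
    ext i
    fin_cases i
    exacts [h0, h.1, h.2]
  · obtain ⟨s, hs⟩ := IsAlgClosed.exists_pow_nat_eq (discrim (c 0) (c 1) (c 2)) two_pos
    obtain ⟨r, hr⟩ := exists_quadratic_eq_zero h0 ⟨s, by rw [← hs, sq]⟩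
    refine ⟨1, -r, c 0, c 1 + c 0 * r, by simp, fun h => h0 h.1, by simp, by ring, ?_⟩
    linear_combination hr

/-- With two branches a linear combination of P₁, P₂ may gain contact with only one of them; a
quadratic form treats one and two branches alike. -/
lemma card_add_le (hF : IsMonicCurve F a b) (hJ : IsBranchFiltration F δ J) {M : ℕ} (hM : δ ≤ M)
    {S : Finset (Fin 2 →₀ ℕ)} (hS : (S : Set (Fin 2 →₀ ℕ)) ⊆ boxSet a b (2 * M)) :
    S.card + δ ≤ 2 * M + 1 := by
  by_contra! hlt
  have := hJ.finite
  have := finite_restrictSupport S.finite_toSet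
  set f := supportToQuotient (S : Set (Fin 2 →₀ ℕ)) (J M)
  have h1 := LinearMap.finrank_range_add_finrank_ker f
  have h2 := Submodule.finrank_le (LinearMap.range f)
  rw [hJ.finrank_eq] at h2
  rw [finrank_restrictSupport, Set.ncard_coe_finset] at h1
  -- As δ ≤ M, the codimension of J M is 2M - δ, at least two less than the size of S.
  have hker : 1 < Module.finrank ℂ (LinearMap.ker f) := by omega
  have := Module.nontrivial_of_finrank_pos (zero_lt_one.trans hker)
  obtain ⟨G₁, hG₁⟩ := exists_ne (0 : LinearMap.ker f)
  obtain ⟨G₂, hG⟩ := exists_linearIndependent_pair_of_one_lt_finrank (R := ℂ)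
    (M := LinearMap.ker f) hker hG₁
  replace hG := LinearIndependent.pair_iff.mp hG
  set P₁ : MvPolynomial (Fin 2) ℂ := G₁.1.1
  set P₂ : MvPolynomial (Fin 2) ℂ := G₂.1.1
  have hP₁ : P₁ ∈ J M := Ideal.Quotient.eq_zero_iff_mem.mp G₁.2
  have hP₂ : P₂ ∈ J M := Ideal.Quotient.eq_zero_iff_mem.mp G₂.2
  have hw₁ : P₁ ∈ restrictSupport ℂ (boxSet a b (2 * M)) := restrictSupport_mono ℂ hS G₁.1.2
  have hw₂ : P₂ ∈ restrictSupport ℂ (boxSet a b (2 * M)) := restrictSupport_mono ℂ hS G₂.1.2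
  have hndvd : ∀ u v : ℂ, ¬ (u = 0 ∧ v = 0) → ¬ F ∣ u • P₁ + v • P₂ := by
    intro u v huv hdvd
    have h0 := eq_zero_of_dvd_of_mem_box hF.coeff_ne_zero
      (Submodule.add_mem _ (Submodule.smul_mem _ u hw₁) (Submodule.smul_mem _ v hw₂)) hdvd
    exact huv (hG u v (Subtype.ext (Subtype.ext h0)))
  let q : (MvPolynomial (Fin 2) ℂ ⧸ J (2 * M + 1)) →ₐ[ℂ] MvPolynomial (Fin 2) ℂ ⧸ J (2 * M) :=
    Ideal.Quotient.factorₐ ℂ (hJ.anti (Nat.le_succ (2 * M)))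
  have hq : Function.Surjective q :=
    Ideal.Quotient.factor_surjective (hJ.anti (Nat.le_succ (2 * M)))
  have h3 := LinearMap.finrank_range_add_finrank_ker q.toLinearMap
  rw [LinearMap.range_eq_top.mpr hq, finrank_top, hJ.finrank_eq, hJ.finrank_eq] at h3
  let Q : Fin 3 → MvPolynomial (Fin 2) ℂ := ![P₁ * P₁, P₁ * P₂, P₂ * P₂]
  have hQJ : ∀ i, Q i ∈ J (2 * M) := by
    rw [two_mul]
    intro i
    fin_cases i
    exacts [hJ.mul_mem hP₁ hP₁, hJ.mul_mem hP₁ hP₂, hJ.mul_mem hP₂ hP₂]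
  let L : (Fin 3 → ℂ) →ₗ[ℂ] LinearMap.ker q.toLinearMap :=
    Fintype.linearCombination ℂ fun i => ⟨Ideal.Quotient.mk _ (Q i), by
      rw [LinearMap.mem_ker]
      exact Ideal.Quotient.eq_zero_iff_mem.mpr (hQJ i)⟩
  -- Three products, but J (2M) / J (2M+1) has dimension 2.
  have hL : LinearMap.ker L ≠ ⊥ := by
    refine LinearMap.ker_ne_bot_of_finrank_lt ?_
    rw [Module.finrank_fin_fun]
    omega
  obtain ⟨c, hcL, hc⟩ := Submodule.exists_mem_ne_zero_of_ne_bot hL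
  have hH : c 0 • (P₁ * P₁) + c 1 • (P₁ * P₂) + c 2 • (P₂ * P₂) ∈ J (2 * M + 1) := by
    rw [LinearMap.mem_ker] at hcL
    have := congrArg Subtype.val hcL
    rw [Fintype.linearCombination_apply, Fin.sum_univ_three] at this
    exact Ideal.Quotient.eq_zero_iff_mem.mp this
  obtain ⟨u, v, u', v', huv, huv', e0, e1, e2⟩ := exists_factors c hc
  have hfac : c 0 • (P₁ * P₁) + c 1 • (P₁ * P₂) + c 2 • (P₂ * P₂)
      = (u • P₁ + v • P₂) * (u' • P₁ + v' • P₂) := by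
    simp only [e0, e1, e2, smul_eq_C_mul, map_add, map_mul]
    ring
  rw [hfac] at hH
  have hlin : ∀ u v : ℂ, u • P₁ + v • P₂ ∈ restrictSupport ℂ (weightSet a b (2 * M)) :=
    fun u v => restrictSupport_mono ℂ (boxSet_subset_weightSet a b _)
      (Submodule.add_mem _ (Submodule.smul_mem _ u hw₁) (Submodule.smul_mem _ v hw₂))
  -- The product has weight at most 4M, whereas Bezout would demand 2(2M+1).
  have := two_mul_le_of_mem hF hJ hH
    (fun h => (hF.prime.dvd_or_dvd h).elim (hndvd u v huv) (hndvd u' v' huv'))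
    (mul_mem_weightSet (hlin u v) (hlin u' v'))
  omega

end Curve

end HirzebruchCurve

/-! ### From an irreducible divisor to an irreducible polynomial containing x^a. -/

namespace HirzebruchCurve

open MvPolynomial

/-! ### Newton polygons -/

lemma HasBidegree.mem_weightSet {F : MvPolynomial (Fin 2) ℂ} {a b : ℕ} (h : HasBidegree F a b) :
    F ∈ restrictSupport ℂ (weightSet a b (a * b)) := by
  intro e he
  have h1 := h (subset_convexHull ℝ _ ⟨e, he, rfl⟩)
  have hconv : Convex ℝ {v : Fin 2 → ℝ | (b : ℝ) * v 0 + a * v 1 ≤ a * b} := by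
    refine convex_halfSpace_le (f := fun v : Fin 2 → ℝ => (b : ℝ) * v 0 + a * v 1) ?_ _
    constructor
    · intro v w; simp only [Pi.add_apply]; ring
    · intro c v; simp only [Pi.smul_apply, smul_eq_mul]; ring
  have h2 := convexHull_min (s := {![(a : ℝ), 0], ![0, 0], ![0, (b : ℝ)]}) (by
    rintro v (rfl | rfl | rfl)
    · simp [mul_comm]
    · simp only [Set.mem_ofPred_eq, Matrix.cons_val_zero, Matrix.cons_val_one,
        Matrix.cons_val_fin_one, mul_zero, add_zero]
      positivity
    · simp) hconv h1
  simp only [Set.mem_ofPred_eq] at h2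
  exact_mod_cast h2

/-! ### Factors of a polynomial of given weighted degree -/

/-- The grading of the polynomial ring with `x` of weight `m` and `y` of weight `1`, as a map to
polynomials in a new variable. -/
noncomputable def gradingMap (m : ℕ) :
    MvPolynomial (Fin 2) ℂ →ₐ[ℂ] Polynomial (MvPolynomial (Fin 2) ℂ) :=
  aeval ![Polynomial.monomial m (X 0), Polynomial.monomial 1 (X 1)]

lemma gradingMap_monomial (m : ℕ) (e : Fin 2 →₀ ℕ) (c : ℂ) :
    gradingMap m (monomial e c) = Polynomial.monomial (m * e 0 + e 1) (monomial e c) := by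
  rw [gradingMap, aeval_monomial, Finsupp.prod_fintype _ _ (fun i => pow_zero _),
    Fin.prod_univ_two, monomial_eq (s := e) (a := c),
    Finsupp.prod_fintype _ _ (fun i => pow_zero _), Fin.prod_univ_two]
  simp only [Matrix.cons_val_zero, Matrix.cons_val_one, Matrix.cons_val_fin_one,
    Polynomial.monomial_pow, Polynomial.monomial_mul_monomial, one_mul]
  rw [IsScalarTower.algebraMap_apply ℂ (MvPolynomial (Fin 2) ℂ), algebraMap_eq,
    Polynomial.algebraMap_eq, Polynomial.C_mul_monomial]

lemma coeff_gradingMap (m d : ℕ) (P : MvPolynomial (Fin 2) ℂ) (e : Fin 2 →₀ ℕ) :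
    coeff e ((gradingMap m P).coeff d) = if m * e 0 + e 1 = d then coeff e P else 0 := by
  induction P using MvPolynomial.induction_on' with
  | add p q hp hq =>
    rw [map_add, Polynomial.coeff_add, coeff_add, hp, hq, coeff_add]
    split_ifs <;> simp
  | monomial f c =>
    rw [gradingMap_monomial, Polynomial.coeff_monomial, coeff_monomial]
    by_cases hfe : f = e
    · subst hfe
      split_ifs <;> simp_all
    · rw [if_neg hfe, ite_self]
      split_ifs
      · rw [coeff_monomial, if_neg hfe]
      · simp

lemma natDegree_gradingMap_le_iff (m d : ℕ) (P : MvPolynomial (Fin 2) ℂ) :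
    (gradingMap m P).natDegree ≤ d ↔ ∀ e ∈ P.support, m * e 0 + e 1 ≤ d := by
  rw [Polynomial.natDegree_le_iff_coeff_eq_zero]
  constructor
  · intro h e he
    by_contra! hlt
    have := coeff_gradingMap m (m * e 0 + e 1) P e
    rw [h _ hlt, if_pos rfl, coeff_zero] at this
    exact mem_support_iff.mp he this.symm
  · intro h N hN
    ext e
    rw [coeff_gradingMap, coeff_zero]
    split_ifs with he
    · by_contra hne
      have := h e (mem_support_iff.mpr hne)
      omega
    · rfl

lemma gradingMap_ne_zero (m : ℕ) {P : MvPolynomial (Fin 2) ℂ} (hP : P ≠ 0) :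
    gradingMap m P ≠ 0 := by
  obtain ⟨e, he⟩ := Finset.nonempty_iff_ne_empty.mpr (mt support_eq_empty.mp hP)
  intro h
  have := coeff_gradingMap m (m * e 0 + e 1) P e
  rw [h, if_pos rfl, Polynomial.coeff_zero, coeff_zero] at this
  exact mem_support_iff.mp he this.symm

lemma mul_degreeOf_le (m : ℕ) {P : MvPolynomial (Fin 2) ℂ} (hP : P ≠ 0) :
    m * degreeOf 0 P ≤ (gradingMap m P).natDegree := by
  obtain ⟨e, he, hd⟩ := Finset.exists_mem_eq_sup P.support
    (Finset.nonempty_iff_ne_empty.mpr (mt support_eq_empty.mp hP)) fun e => e 0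
  rw [degreeOf_eq_sup, hd]
  exact (Nat.le_add_right _ _).trans ((natDegree_gradingMap_le_iff m _ P).mp le_rfl e he)

/-- Weighted degree is additive and is at least m times the x-degree for each factor. A product
attaining this minimum forces both factors to attain it. -/
lemma weight_le_of_mul {G H : MvPolynomial (Fin 2) ℂ} {m : ℕ} (hG : G ≠ 0) (hH : H ≠ 0)
    (h : ∀ e ∈ (G * H).support, m * e 0 + e 1 ≤ m * degreeOf 0 (G * H)) :
    ∀ e ∈ G.support, m * e 0 + e 1 ≤ m * degreeOf 0 G := by
  rw [← natDegree_gradingMap_le_iff] at h ⊢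
  rw [map_mul, Polynomial.natDegree_mul (gradingMap_ne_zero m hG) (gradingMap_ne_zero m hH),
    degreeOf_mul_eq hG hH, mul_add] at h
  have := mul_degreeOf_le m hH
  omega

/-! ### Rational functions on the charts -/

lemma localDiv_mul (R : Subalgebra ℂ FunField) (g h : FunFieldˣ) :
    localDiv R (g * h) = localDiv R g + localDiv R h := rfl

lemma localDiv_inv (R : Subalgebra ℂ FunField) (g : FunFieldˣ) :
    localDiv R g⁻¹ = -localDiv R g := rfl

lemma localDiv_pow (R : Subalgebra ℂ FunField) (g : FunFieldˣ) (n : ℕ) :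
    localDiv R (g ^ n) = n • localDiv R g := rfl

lemma localDiv_eq_iff {R : Subalgebra ℂ FunField} {g h : FunFieldˣ} :
    localDiv R g = localDiv R h ↔ g⁻¹ * h ∈ unitGroup R := QuotientAddGroup.eq

lemma localDiv_eq_zero_iff {R : Subalgebra ℂ FunField} {g : FunFieldˣ} :
    localDiv R g = 0 ↔ g ∈ unitGroup R := QuotientAddGroup.eq_zero_iff _

lemma ofPoly_mul (P Q : MvPolynomial (Fin 2) ℂ) : ofPoly (P * Q) = ofPoly P * ofPoly Q :=
  map_mul _ _ _

lemma ofPoly_injective : Function.Injective ofPoly :=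
  IsFractionRing.injective (MvPolynomial (Fin 2) ℂ) FunField

lemma ofPoly_ne_zero {P : MvPolynomial (Fin 2) ℂ} (hP : P ≠ 0) : ofPoly P ≠ 0 := fun h =>
  hP (ofPoly_injective (h.trans (map_zero (algebraMap _ FunField)).symm))

/-- A nonzero polynomial as a nonzero rational function. -/
noncomputable def polyUnit (P : MvPolynomial (Fin 2) ℂ) (hP : P ≠ 0) : FunFieldˣ :=
  Units.mk0 (ofPoly P) (ofPoly_ne_zero hP)

lemma ofPoly_monomial (e : Fin 2 →₀ ℕ) (c : ℂ) :
    ofPoly (monomial e c) = c • ((xx : FunField) ^ e 0 * (yy : FunField) ^ e 1) := by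
  have hm : monomial e c = c • (X 0 ^ e 0 * X 1 ^ e 1 : MvPolynomial (Fin 2) ℂ) := by
    rw [monomial_eq, Finsupp.prod_fintype _ _ (fun i => pow_zero _), smul_eq_C_mul]
    simp
  have hs : ∀ P : MvPolynomial (Fin 2) ℂ, ofPoly (c • P) = c • ofPoly P := fun P =>
    (IsScalarTower.toAlgHom ℂ (MvPolynomial (Fin 2) ℂ) FunField).toLinearMap.map_smul c P
  rw [hm, hs]
  simp [ofPoly, xx, yy]

lemma ofPoly_mul_mem {R : Subalgebra ℂ FunField} {P : MvPolynomial (Fin 2) ℂ} {u : FunField}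
    (h : ∀ e ∈ P.support, (xx : FunField) ^ e 0 * (yy : FunField) ^ e 1 * u ∈ R) :
    ofPoly P * u ∈ R := by
  have hsum : ofPoly P = ∑ e ∈ P.support, ofPoly (monomial e (coeff e P)) := by
    conv_lhs => rw [P.as_sum]
    exact map_sum (algebraMap _ FunField) _ _
  rw [hsum, Finset.sum_mul]
  refine sum_mem fun e he => ?_
  rw [ofPoly_monomial, smul_mul_assoc]
  exact R.smul_mem (h e he) _

lemma ratioX_zero (m : ℕ) : ratioX m 0 = xx * (yy ^ m)⁻¹ := if_pos rfl

lemma ratioX_one (m : ℕ) : ratioX m 1 = xx := if_neg one_ne_zero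

lemma coordX_zero (m : ℕ) (j : Fin 2) : coordX m (0, j) = (ratioX m j)⁻¹ := if_pos rfl

lemma coordX_one (m : ℕ) (j : Fin 2) : coordX m (1, j) = ratioX m j := if_neg one_ne_zero

lemma coordY_zero (i : Fin 2) : coordY (i, 0) = yy⁻¹ := if_pos rfl

lemma coordY_one (i : Fin 2) : coordY (i, 1) = yy := if_neg one_ne_zero

lemma sectionPlusEqn_zero (m : ℕ) (j : Fin 2) : sectionPlusEqn m (0, j) = 1 := if_pos rfl

lemma sectionPlusEqn_one (m : ℕ) (j : Fin 2) : sectionPlusEqn m (1, j) = ratioX m j :=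
  (if_neg one_ne_zero).trans (coordX_one m j)

lemma coord_pow_mem (m : ℕ) (c : Chart) {g : FunFieldˣ} (i j : ℕ)
    (h : g = coordX m c ^ i * coordY c ^ j) : (g : FunField) ∈ chartRing m c := by
  rw [h, Units.val_mul, Units.val_pow_eq_pow_val, Units.val_pow_eq_pow_val]
  exact mul_mem (pow_mem (coordX_mem m c) i) (pow_mem (coordY_mem m c) j)

lemma polyUnit_mul_mem {R : Subalgebra ℂ FunField} {P : MvPolynomial (Fin 2) ℂ} (hP : P ≠ 0)
    {u : FunFieldˣ} (h : ∀ e ∈ P.support, ((xx ^ e 0 * yy ^ e 1 * u : FunFieldˣ) : FunField) ∈ R) :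
    ((polyUnit P hP * u : FunFieldˣ) : FunField) ∈ R := by
  rw [Units.val_mul]
  exact ofPoly_mul_mem fun e he => by simpa using h e he

lemma mem_unitGroup_affine {m : ℕ} {u : FunFieldˣ} (hu : u ∈ unitGroup (chartRing m (1, 1))) :
    ∃ P : MvPolynomial (Fin 2) ℂ, IsUnit P ∧ (u : FunField) = ofPoly P := by
  have hle : chartRing m (1, 1) ≤
      (IsScalarTower.toAlgHom ℂ (MvPolynomial (Fin 2) ℂ) FunField).range := by
    rw [chartRing, coordX_one, ratioX_one, coordY_one, Algebra.adjoin_le_iff]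
    rintro _ (rfl | rfl)
    exacts [⟨X 0, rfl⟩, ⟨X 1, rfl⟩]
  obtain ⟨P, hP⟩ := hle hu.1
  obtain ⟨Q, hQ⟩ := hle hu.2
  refine ⟨P, IsUnit.of_mul_eq_one Q (ofPoly_injective ?_), hP.symm⟩
  have h1 : ofPoly P = u := hP
  have h2 : ofPoly Q = (u⁻¹ : FunFieldˣ) := hQ
  rw [ofPoly_mul, h1, h2, Units.mul_inv]
  exact (map_one (algebraMap _ FunField)).symm

lemma isUnit_of_polyUnit_mem {m : ℕ} {P : MvPolynomial (Fin 2) ℂ} {hP : P ≠ 0}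
    (h : polyUnit P hP ∈ unitGroup (chartRing m (1, 1))) : IsUnit P := by
  obtain ⟨Q, hQ, he⟩ := mem_unitGroup_affine h
  rwa [ofPoly_injective (show ofPoly P = ofPoly Q from he)]

/-- Units of ℂ[x, y] are constants. Hence a divisor in the class of aS₊ is determined by its
restriction to the affine plane. -/
lemma mem_unitGroup_of_affine {m : ℕ} {u : FunFieldˣ} (hu : u ∈ unitGroup (chartRing m (1, 1)))
    (R : Subalgebra ℂ FunField) : u ∈ unitGroup R := by
  have key : ∀ v ∈ unitGroup (chartRing m (1, 1)), (v : FunField) ∈ R := by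
    intro v hv
    obtain ⟨P, hP, he⟩ := mem_unitGroup_affine hv
    rw [MvPolynomial.isUnit_iff_eq_C_of_isReduced] at hP
    obtain ⟨c, -, rfl⟩ := hP
    rw [he, ofPoly, ← algebraMap_eq, ← IsScalarTower.algebraMap_apply]
    exact R.algebraMap_mem c
  exact ⟨key u hu, key _ (inv_mem hu)⟩

/-- Elements of ℂ[x⁻¹, y] have no positive degree in x. This is what makes the section x₁ = 0 a
nonzero divisor. -/
lemma xx_notMem_chartRing (m : ℕ) : (xx : FunField) ∉ chartRing m (0, 1) := by
  have key : ∀ z ∈ chartRing m (0, 1), ∃ (n : ℕ) (P : MvPolynomial (Fin 2) ℂ),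
      degreeOf 0 P ≤ n ∧ z * (xx : FunField) ^ n = ofPoly P := by
    have hX : ∀ n, (xx : FunField) ^ n = ofPoly (X 0 ^ n) := fun n =>
      (map_pow (algebraMap _ FunField) _ _).symm
    have hdX : ∀ n, degreeOf 0 (X 0 ^ n : MvPolynomial (Fin 2) ℂ) ≤ n := fun n => by
      simp
    intro z hz
    rw [chartRing, coordX_zero, ratioX_one, coordY_one] at hz
    induction hz using Algebra.adjoin_induction with
    | mem z hz =>
      rcases hz with rfl | rfl
      · exact ⟨1, 1, by simp, by
          rw [pow_one, Units.inv_mul]; exact (map_one (algebraMap _ FunField)).symm⟩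
      · exact ⟨0, X 1, by simp [degreeOf_X], by rw [pow_zero, mul_one]; rfl⟩
    | algebraMap c =>
      refine ⟨0, C c, by simp, ?_⟩
      rw [pow_zero, mul_one, IsScalarTower.algebraMap_apply ℂ (MvPolynomial (Fin 2) ℂ)]
      rfl
    | add z w _ _ hz hw =>
      obtain ⟨n, P, hP, hzP⟩ := hz
      obtain ⟨n', Q, hQ, hwQ⟩ := hw
      refine ⟨n + n', P * X 0 ^ n' + Q * X 0 ^ n, ?_, ?_⟩
      · refine (degreeOf_add_le _ _ _).trans (max_le ?_ ?_)
        · exact (degreeOf_mul_le _ _ _).trans (add_le_add hP (hdX _))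
        · exact (degreeOf_mul_le _ _ _).trans ((add_le_add hQ (hdX _)).trans (add_comm _ _).le)
      · have : ofPoly (P * X 0 ^ n' + Q * X 0 ^ n)
            = ofPoly (P * X 0 ^ n') + ofPoly (Q * X 0 ^ n) := map_add _ _ _
        rw [this, ofPoly_mul, ofPoly_mul, ← hX, ← hX, ← hzP, ← hwQ]
        ring
    | mul z w _ _ hz hw =>
      obtain ⟨n, P, hP, hzP⟩ := hz
      obtain ⟨n', Q, hQ, hwQ⟩ := hw
      refine ⟨n + n', P * Q, (degreeOf_mul_le _ _ _).trans (add_le_add hP hQ), ?_⟩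
      rw [ofPoly_mul, ← hzP, ← hwQ]
      ring
  intro h
  obtain ⟨n, P, hP, he⟩ := key _ h
  have : P = X 0 ^ (n + 1) := ofPoly_injective (by
    rw [← he, ← pow_succ']
    exact (map_pow (algebraMap _ FunField) _ _).symm)
  rw [this, degreeOf_pow_eq _ _ _ (X_ne_zero _), degreeOf_X, if_pos rfl] at hP
  omega

/-! ### Divisors of polynomials -/

/-- The divisor, linearly equivalent to `n S₊`, whose restriction to the affine plane `U (1, 1)` is
the divisor of `g`. -/
noncomputable def affineDivisor (m : ℕ) (g : FunFieldˣ) (n : ℕ) : Divisor m :=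
  Divisor.principal m (g * (xx ^ n)⁻¹) + n • sectionPlus m

lemma affineDivisor_apply (m : ℕ) (g : FunFieldˣ) (n : ℕ) (c : Chart) :
    (affineDivisor m g n).1 c
      = localDiv (chartRing m c) (g * ((xx ^ n)⁻¹ * sectionPlusEqn m c ^ n)) := by
  rw [← mul_assoc, localDiv_mul _ (g * _), localDiv_pow]
  rfl

lemma affineDivisor_affine (m : ℕ) (g : FunFieldˣ) (n : ℕ) :
    (affineDivisor m g n).1 (1, 1) = localDiv (chartRing m (1, 1)) g := by
  rw [affineDivisor_apply, sectionPlusEqn_one, ratioX_one, inv_mul_cancel, mul_one]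

lemma affineDivisor_mul (m : ℕ) (g g' : FunFieldˣ) (n n' : ℕ) :
    affineDivisor m (g * g') (n + n') = affineDivisor m g n + affineDivisor m g' n' := by
  refine Subtype.ext (funext fun c => ?_)
  change (affineDivisor m (g * g') (n + n')).1 c
    = (affineDivisor m g n).1 c + (affineDivisor m g' n').1 c
  rw [affineDivisor_apply, affineDivisor_apply, affineDivisor_apply, ← localDiv_mul]
  congr 1
  rw [pow_add, pow_add, mul_inv]
  simp only [mul_assoc, mul_left_comm, mul_comm]

lemma monomial_eqn_base_infinity {m i j n r : ℕ} (h : m * n = m * i + j + r) :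
    xx ^ i * yy ^ j * ((xx ^ n)⁻¹ * (xx * (yy ^ m)⁻¹) ^ n)
      = (xx * (yy ^ m)⁻¹) ^ i * yy⁻¹ ^ r := by
  rw [mul_pow, inv_mul_cancel_left, mul_pow, inv_pow, inv_pow, inv_pow, ← pow_mul, ← pow_mul, h,
    pow_add, pow_add, mul_inv, mul_inv, mul_comm (yy ^ (m * i))⁻¹, mul_assoc (yy ^ j)⁻¹,
    mul_assoc (xx ^ i), mul_inv_cancel_left, mul_assoc]

lemma monomial_eqn_both_infinity {m i j l r : ℕ} (h : m * l = j + r) :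
    xx ^ i * yy ^ j * (xx ^ (i + l))⁻¹ = ((xx * (yy ^ m)⁻¹)⁻¹) ^ l * yy⁻¹ ^ r := by
  rw [mul_inv, inv_inv, mul_pow, ← pow_mul, h, pow_add, pow_add, mul_inv, inv_pow, inv_pow,
    mul_assoc (_ ^ l)⁻¹, mul_inv_cancel_right, mul_right_comm, mul_inv_cancel_left]

/-- In every chart a monomial of P becomes a monomial in the chart coordinates; the exponents at
infinity are the slacks l = n - i and r = mn - mi - j. -/
lemma isEffective_affineDivisor {m n : ℕ} (hm : 1 ≤ m) {P : MvPolynomial (Fin 2) ℂ} (hP : P ≠ 0)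
    (h : ∀ e ∈ P.support, m * e 0 + e 1 ≤ m * n) :
    IsEffective (affineDivisor m (polyUnit P hP) n) := by
  intro c
  refine ⟨_, polyUnit_mul_mem hP fun e he => ?_, affineDivisor_apply m _ n c⟩
  have hle := h e he
  have hn : e 0 ≤ n := Nat.le_of_mul_le_mul_left ((Nat.le_add_right _ _).trans hle) hm
  obtain ⟨l, rfl⟩ := Nat.exists_eq_add_of_le hn
  obtain ⟨r, hr⟩ := Nat.exists_eq_add_of_le hle
  obtain ⟨i, j⟩ := c
  have h01 : ∀ t : Fin 2, t = 0 ∨ t = 1 := by decide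
  rcases h01 i with rfl | rfl <;> rcases h01 j with rfl | rfl
  · refine coord_pow_mem m _ l r ?_
    rw [sectionPlusEqn_zero, one_pow, mul_one, coordX_zero, ratioX_zero, coordY_zero]
    refine monomial_eqn_both_infinity ?_
    rw [mul_add] at hr
    omega
  · refine coord_pow_mem m _ l (e 1) ?_
    rw [sectionPlusEqn_zero, one_pow, mul_one, coordX_zero, ratioX_one, coordY_one, pow_add,
      mul_inv, mul_right_comm, mul_inv_cancel_left, inv_pow]
  · refine coord_pow_mem m _ (e 0) r ?_
    rw [sectionPlusEqn_one, coordX_one, ratioX_zero, coordY_zero]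
    exact monomial_eqn_base_infinity hr
  · refine coord_pow_mem m _ (e 0) (e 1) ?_
    rw [sectionPlusEqn_one, coordX_one, ratioX_one, coordY_one, inv_mul_cancel, mul_one]

lemma eq_affineDivisor {m a : ℕ} {F : MvPolynomial (Fin 2) ℂ} {C : Divisor m}
    (hC : IsDivisorOf a F C) (hF : F ≠ 0) : C = affineDivisor m (polyUnit F hF) a := by
  obtain ⟨-, ⟨h, hh⟩, g, hg, hgC⟩ := hC
  have hgF : g = polyUnit F hF := Units.ext hg
  subst hgF
  have hc : ∀ c, C.1 c = localDiv (chartRing m c) (h * sectionPlusEqn m c ^ a) := by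
    intro c
    have h1 : C = Divisor.principal m h + a • sectionPlus m := by rw [← hh, sub_add_cancel]
    rw [h1, localDiv_mul, localDiv_pow]
    rfl
  have hu : (h * xx ^ a)⁻¹ * polyUnit F hF ∈ unitGroup (chartRing m (1, 1)) := by
    rw [← localDiv_eq_iff, ← hgC, hc, sectionPlusEqn_one, ratioX_one]
  refine Subtype.ext (funext fun c => ?_)
  rw [hc, affineDivisor_apply, localDiv_eq_iff]
  convert mem_unitGroup_of_affine hu (chartRing m c) using 1
  rw [mul_inv, mul_inv, ← mul_assoc (polyUnit F hF), mul_comm (polyUnit F hF * _),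
    mul_assoc h⁻¹, inv_mul_cancel_left, mul_assoc h⁻¹, mul_comm (polyUnit F hF)]

/-- The divisor with local equations `x₀ / (x₁ y_j ^ m)`. -/
noncomputable def ratioDivisor (m : ℕ) : Divisor m :=
  Divisor.ofEquations m (fun c => ratioX m c.2) (ratioX_compat m)

/-- The section `x₁ = 0`. -/
noncomputable def sectionMinus (m : ℕ) : Divisor m := sectionPlus m - ratioDivisor m

lemma sectionMinus_apply (m : ℕ) (c : Chart) :
    (sectionMinus m).1 c
      = localDiv (chartRing m c) (sectionPlusEqn m c * (ratioX m c.2)⁻¹) := by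
  rw [localDiv_mul, localDiv_inv, ← sub_eq_add_neg]
  rfl

lemma isEffective_sectionMinus (m : ℕ) : IsEffective (sectionMinus m) := by
  rintro ⟨i, j⟩
  refine ⟨_, ?_, sectionMinus_apply m _⟩
  have h01 : ∀ t : Fin 2, t = 0 ∨ t = 1 := by decide
  rcases h01 i with rfl | rfl
  · rw [sectionPlusEqn_zero, one_mul, ← coordX_zero]
    exact coordX_mem m _
  · rw [sectionPlusEqn_one, mul_inv_cancel]
    exact one_mem _

lemma sectionMinus_ne_zero (m : ℕ) : sectionMinus m ≠ 0 := by
  intro h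
  have h0 : (sectionMinus m).1 (0, 1) = 0 := by rw [h]; rfl
  rw [sectionMinus_apply, localDiv_eq_zero_iff, sectionPlusEqn_zero, one_mul, ratioX_one] at h0
  have := h0.2
  rw [inv_inv] at this
  exact xx_notMem_chartRing m this

lemma affineDivisor_sub_sectionMinus_apply (m : ℕ) (g : FunFieldˣ) (n : ℕ) (c : Chart) :
    (affineDivisor m g (n + 1) - sectionMinus m).1 c = localDiv (chartRing m c)
      (g * ((xx ^ (n + 1))⁻¹ * sectionPlusEqn m c ^ n * ratioX m c.2)) := by
  change (affineDivisor m g (n + 1)).1 c - (sectionMinus m).1 c = _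
  rw [affineDivisor_apply, sectionMinus_apply, sub_eq_add_neg, ← localDiv_inv, ← localDiv_mul]
  congr 1
  rw [mul_inv, inv_inv, pow_succ (sectionPlusEqn m c)]
  simp only [mul_assoc, mul_inv_cancel_left]

lemma isEffective_affineDivisor_sub_sectionMinus {m n : ℕ} {P : MvPolynomial (Fin 2) ℂ}
    (hP : P ≠ 0) (h : ∀ e ∈ P.support, e 0 ≤ n ∧ m * e 0 + e 1 ≤ m * (n + 1)) :
    IsEffective (affineDivisor m (polyUnit P hP) (n + 1) - sectionMinus m) := by
  intro c
  refine ⟨_, polyUnit_mul_mem hP fun e he => ?_, affineDivisor_sub_sectionMinus_apply m _ n c⟩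
  obtain ⟨hn, hle⟩ := h e he
  obtain ⟨l, rfl⟩ := Nat.exists_eq_add_of_le hn
  obtain ⟨r, hr⟩ := Nat.exists_eq_add_of_le hle
  obtain ⟨i, j⟩ := c
  have h01 : ∀ t : Fin 2, t = 0 ∨ t = 1 := by decide
  rcases h01 i with rfl | rfl <;> rcases h01 j with rfl | rfl
  · refine coord_pow_mem m _ l r ?_
    have e1 := monomial_eqn_both_infinity (m := m) (i := e 0) (j := e 1) (l := l + 1) (r := r) (by
      rw [mul_add, mul_add] at hr
      rw [mul_add]
      omega)
    rw [sectionPlusEqn_zero, one_pow, mul_one, coordX_zero, ratioX_zero, coordY_zero, add_assoc,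
      ← mul_assoc, e1, pow_succ, mul_right_comm, mul_assoc _ _ (xx * _), inv_mul_cancel, mul_one]
  · refine coord_pow_mem m _ l (e 1) ?_
    rw [sectionPlusEqn_zero, one_pow, mul_one, coordX_zero, ratioX_one, coordY_one, pow_succ,
      mul_inv, inv_mul_cancel_right, pow_add, mul_inv, mul_right_comm, mul_inv_cancel_left, inv_pow]
  · refine coord_pow_mem m _ (e 0) r ?_
    rw [sectionPlusEqn_one, coordX_one, ratioX_zero, coordY_zero, mul_assoc (xx ^ _)⁻¹, ← pow_succ]
    exact monomial_eqn_base_infinity hr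
  · refine coord_pow_mem m _ (e 0) (e 1) ?_
    rw [sectionPlusEqn_one, coordX_one, ratioX_one, coordY_one, mul_assoc (xx ^ _)⁻¹, ← pow_succ,
      inv_mul_cancel, mul_one]

lemma eq_expo_of_le {m a : ℕ} (hm : 1 ≤ m) {e : Fin 2 →₀ ℕ} (h : m * e 0 + e 1 ≤ m * a) :
    e 0 < a ∨ e = expo a 0 := by
  have hle : e 0 ≤ a := Nat.le_of_mul_le_mul_left ((Nat.le_add_right _ _).trans h) hm
  rcases hle.lt_or_eq with hlt | heq
  · exact Or.inl hlt
  · right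
    rw [heq] at h
    rw [← expo_eta e, heq, show e 1 = 0 by omega]

/-- Without x^a the section x₁ = 0 splits off as an effective summand. The remainder is nonzero
because it restricts to the divisor of the nonconstant F. -/
theorem coeff_ne_zero_of_isIrreducible {m a : ℕ} (hm : 1 ≤ m) (ha : 1 ≤ a)
    {F : MvPolynomial (Fin 2) ℂ} (hF : F ≠ 0) (hFu : ¬ IsUnit F)
    (hwt : ∀ e ∈ F.support, m * e 0 + e 1 ≤ m * a)
    (hirr : IsIrreducible (affineDivisor m (polyUnit F hF) a)) : coeff (expo a 0) F ≠ 0 := by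
  intro hc
  obtain ⟨n, rfl⟩ := Nat.exists_eq_add_of_le' ha
  have heff := isEffective_affineDivisor_sub_sectionMinus (m := m) (n := n) hF fun e he => by
    refine ⟨?_, hwt e he⟩
    rcases eq_expo_of_le hm (hwt e he) with h | rfl
    · omega
    · exact absurd hc (mem_support_iff.mp he)
  rcases hirr.2.2 _ _ (isEffective_sectionMinus m) heff (by abel) with h | h
  · exact sectionMinus_ne_zero m h
  · have h0 : (affineDivisor m (polyUnit F hF) (n + 1) - sectionMinus m).1 (1, 1) = 0 := by
      rw [h]; rfl
    rw [affineDivisor_sub_sectionMinus_apply, localDiv_eq_zero_iff, sectionPlusEqn_one, ratioX_one,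
      mul_assoc (xx ^ _)⁻¹, ← pow_succ, inv_mul_cancel, mul_one] at h0
    exact hFu (isUnit_of_polyUnit_mem h0)

/-- A factorisation F = GH splits the divisor, with a distributed according to x-degrees;
`weight_le_of_mul` makes both summands effective. -/
theorem irreducible_of_isIrreducible {m a : ℕ} (hm : 1 ≤ m)
    {F : MvPolynomial (Fin 2) ℂ} (hF : F ≠ 0) (hFu : ¬ IsUnit F)
    (hwt : ∀ e ∈ F.support, m * e 0 + e 1 ≤ m * a) (hc : coeff (expo a 0) F ≠ 0)
    (hirr : IsIrreducible (affineDivisor m (polyUnit F hF) a)) : Irreducible F := by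
  have hdeg : degreeOf 0 F = a := by
    refine le_antisymm (degreeOf_le_iff.mpr fun e he => ?_) ?_
    · rcases eq_expo_of_le hm (hwt e he) with h | rfl
      · exact h.le
      · simp
    · simpa using monomial_le_degreeOf 0 (mem_support_iff.mpr hc)
  refine ⟨hFu, fun G H hGH => ?_⟩
  subst hGH
  have hG : G ≠ 0 := left_ne_zero_of_mul hF
  have hH : H ≠ 0 := right_ne_zero_of_mul hF
  subst hdeg
  have hwG := weight_le_of_mul hG hH hwt
  have hwH := weight_le_of_mul hH hG (by rwa [mul_comm H G])
  have hsplit : affineDivisor m (polyUnit (G * H) hF) (degreeOf 0 (G * H))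
      = affineDivisor m (polyUnit G hG) (degreeOf 0 G)
        + affineDivisor m (polyUnit H hH) (degreeOf 0 H) := by
    rw [← affineDivisor_mul, degreeOf_mul_eq hG hH]
    congr 1
    exact Units.ext (ofPoly_mul G H)
  have key : ∀ {P : MvPolynomial (Fin 2) ℂ} {hP : P ≠ 0} {n : ℕ},
      affineDivisor m (polyUnit P hP) n = 0 → IsUnit P := by
    intro P hP n h
    have h0 : (affineDivisor m (polyUnit P hP) n).1 (1, 1) = 0 := by rw [h]; rfl
    rw [affineDivisor_affine, localDiv_eq_zero_iff] at h0
    exact isUnit_of_polyUnit_mem h0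
  exact (hirr.2.2 _ _ (isEffective_affineDivisor hm hG hwG) (isEffective_affineDivisor hm hH hwH)
    hsplit).imp key key

end HirzebruchCurve

/-! ### Lattice point count and conclusion. -/

namespace HirzebruchCurve

open MvPolynomial

lemma HasSingularityA.eval_eq_zero {F : MvPolynomial (Fin 2) ℂ} {k : ℕ} {p : Fin 2 → ℂ}
    (hp : HasSingularityA F k p) : eval p F = 0 := by
  obtain ⟨χ, w, -, hp0, -, -, -, -, hF⟩ := hp
  simpa [hp0] using hF.self_of_nhds

lemma HasBidegree.weight_le {F : MvPolynomial (Fin 2) ℂ} {a m r : ℕ} (hm : 1 ≤ m) (hr : r < a)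
    (hF : HasBidegree F a (a * m - r)) : ∀ e ∈ F.support, m * e 0 + e 1 ≤ m * a := by
  intro e he
  have h : (a * m - r) * e 0 + a * e 1 ≤ a * (a * m - r) := hF.mem_weightSet he
  have ham : a ≤ a * m := Nat.le_mul_of_pos_right a hm
  have he0 : e 0 ≤ a := by
    refine Nat.le_of_mul_le_mul_left (c := a * m - r) ?_ (by omega)
    rw [mul_comm _ a]
    omega
  zify [show r ≤ a * m by omega] at h he0 ⊢
  have ha : (0 : ℤ) < a := by omega
  refine le_of_mul_le_mul_left ?_ ha
  -- After multiplication by a, the slack is r(a - i) ≥ 0.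
  nlinarith [mul_nonneg (Int.natCast_nonneg r) (sub_nonneg.mpr he0)]

/-- The exponents `(i, j)` with `i < a` and `m i + j ≤ h`, provided that `m a ≤ h`. -/
noncomputable def triangle (a m h : ℕ) : Finset (Fin 2 →₀ ℕ) :=
  ((Finset.range a).sigma fun i => Finset.range (h - m * i + 1)).map ⟨_, expo_injective⟩

lemma mem_triangle {a m h : ℕ} {e : Fin 2 →₀ ℕ} :
    e ∈ triangle a m h ↔ e 0 < a ∧ e 1 < h - m * e 0 + 1 := by
  simp only [triangle, Finset.mem_map, Finset.mem_sigma, Finset.mem_range,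
    Function.Embedding.coeFn_mk]
  constructor
  · rintro ⟨s, hs, rfl⟩
    simpa using hs
  · exact fun h => ⟨⟨e 0, e 1⟩, h, expo_eta e⟩

lemma two_mul_card_triangle {a m h : ℕ} (hh : m * a ≤ h) :
    2 * ((triangle a m h).card : ℤ) = 2 * a * (h + 1) - m * a * (a - 1) := by
  have key : ∀ n ≤ a, 2 * ((∑ i ∈ Finset.range n, (h - m * i + 1) : ℕ) : ℤ)
      = 2 * n * (h + 1) - m * n * (n - 1) := by
    intro n
    induction n with
    | zero => simp
    | succ n ih =>
      intro hn
      have : m * n ≤ h := (Nat.mul_le_mul_left m (by omega)).trans hh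
      rw [Finset.sum_range_succ, Nat.cast_add, mul_add, ih (by omega)]
      push_cast [this]
      ring
  rw [← key a le_rfl, triangle, Finset.card_map, Finset.card_sigma]
  simp

lemma triangle_subset_boxSet {a b m h : ℕ} (hb : b ≤ a * m) (hh : m * a ≤ h) :
    (triangle a m h : Set (Fin 2 →₀ ℕ)) ⊆ boxSet a b (a * h) := by
  intro e he
  obtain ⟨h0, h1⟩ := mem_triangle.mp he
  refine ⟨h0, ?_⟩
  have h2 : m * e 0 ≤ h := (Nat.mul_le_mul_left m h0.le).trans hh
  calc b * e 0 + a * e 1 ≤ a * m * e 0 + a * e 1 := by gcongr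
    _ = a * (m * e 0 + e 1) := by ring
    _ ≤ a * h := Nat.mul_le_mul_left a (by omega)

end HirzebruchCurve

open HirzebruchCurve MvPolynomial in
theorem lemma3p7 (a m r k : ℕ) (ha : 1 ≤ a) (hm : 1 ≤ m) (hr : r < a)
    (F : MvPolynomial (Fin 2) ℂ) (hF : HirzebruchCurve.HasBidegree F a (a * m - r))
    (p : Fin 2 → ℂ) (hp : HirzebruchCurve.HasSingularityA F k p)
    (C : HirzebruchCurve.Divisor m) (hC : HirzebruchCurve.IsDivisorOf a F C)
    (hirr : HirzebruchCurve.IsIrreducible C) :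
    (k : ℤ) ≤ ((a : ℤ) - 1) * ((a : ℤ) * (m : ℤ) - 2) ∧
      (3 ≤ a → r = 2 → (k : ℤ) ≤ ((a : ℤ) - 1) * ((a : ℤ) * (m : ℤ) - 2) - 2) := by
  have hF0 : F ≠ 0 := by
    rintro rfl
    obtain ⟨-, -, g, hg, -⟩ := hC
    exact g.ne_zero (hg.trans (map_zero _))
  have hFu : ¬ IsUnit F := fun h => (h.map (eval p)).ne_zero hp.eval_eq_zero
  have hwt := hF.weight_le hm hr
  rw [eq_affineDivisor hC hF0] at hirr
  have hc := coeff_ne_zero_of_isIrreducible hm ha hF0 hFu hwt hirr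
  have hprime := (irreducible_of_isIrreducible hm hF0 hFu hwt hc hirr).prime
  obtain ⟨J, hJ⟩ := exists_isBranchFiltration hp
  set δ := (k + 1) / 2 with hδ
  -- Any large n serves, since it cancels in the final inequality; this one ensures δ ≤ an and ma ≤
  -- 2n.
  set n := δ + m * a with hn
  have hkδ : (k : ℤ) ≤ 2 * δ := by omega
  have hM : δ ≤ a * n := by
    have : n ≤ a * n := Nat.le_mul_of_pos_left _ ha
    omega
  have hh : m * a ≤ 2 * n := by omega
  have hcard := two_mul_card_triangle hh
  have h2 : a * (2 * n) = 2 * (a * n) := by ring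
  constructor
  · have hcurve : IsMonicCurve F a (a * m) := by
      refine ⟨hprime, hc, ha, Nat.mul_pos ha hm, fun e he => ?_⟩
      calc a * m * e 0 + a * e 1 = a * (m * e 0 + e 1) := by ring
        _ ≤ a * (m * a) := Nat.mul_le_mul_left a (hwt e he)
        _ = a * (a * m) := by ring
    have hS := triangle_subset_boxSet (b := a * m) le_rfl hh
    rw [h2] at hS
    have := card_add_le hcurve hJ hM hS
    zify at this
    push_cast at hcard
    -- With M = an and 2|S| = 2a(2n+1) - ma(a-1), what remains is 2δ ≤ (a-1)(am-2).
    linarith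
  · rintro ha3 rfl
    have ham : 3 ≤ a * m := ha3.trans (Nat.le_mul_of_pos_right a hm)
    have hcurve : IsMonicCurve F a (a * m - 2) :=
      ⟨hprime, hc, ha, by omega, hF.mem_weightSet⟩
    have hS := triangle_subset_boxSet (b := a * m - 2) (Nat.sub_le _ _) hh
    -- The exponent just above the top of the last column has weight 2an - (a - 2) for b = am - 2,
    -- so it still fits and adds one to the count.
    set e := expo (a - 1) (2 * n - m * (a - 1) + 1) with he
    have heS : e ∉ triangle a m (2 * n) := by
      rw [mem_triangle]
      simp [he]
    have heB : e ∈ boxSet a (a * m - 2) (a * (2 * n)) := by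
      have h3 : m * (a - 1) ≤ 2 * n := (Nat.mul_le_mul_left m (Nat.sub_le a 1)).trans hh
      refine ⟨by simp only [he, expo_apply_zero]; omega, ?_⟩
      simp only [he, expo_apply_zero, expo_apply_one]
      zify [h3, ha, show 2 ≤ a * m by omega] at ha3 ⊢
      linarith
    rw [h2] at hS heB
    have := card_add_le hcurve hJ hM (S := Finset.cons e _ heS) (by
      rw [Finset.coe_cons]
      exact Set.insert_subset heB hS)
    rw [Finset.card_cons] at this
    zify at this
    push_cast at hcard
    linarith
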